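/- Let $\mathbb K\in\{\mathbb R,\mathbb C\}$, let $X$ be a $\mathbb K$-Banach space, $\mathcal L(X)$ the Banach algebra of bounded operators on $X$, and $GL(X)$ its group of invertible elements, regarded as an open submanifold of $\mathcal L(X)$. All manifolds are Hausdorff $\mathbb K$-analytic Banach manifolds (the charts may take values in different Banach spaces); submanifolds and submersions are split (the range, respectively the kernel, of the derivative is complemented). Let $\mathcal I(X)=\{Q\in\mathcal L(X)\setminus\{0,I\}: Q^2=Q\}$ with the norm topology. Let $\mathcal G(X)$ be the set of non-zero proper complemented closed subspaces of $X$, with the Grassmann manifold structure whose charts are, for $E,F\in\mathcal G(X)$ with $E\oplus F=X$, the inverses of the maps $T\mapsto (I+T)(E)$ from $\mathcal L(E,F)$ onto the set of complements of $F$. The group $GL(X)$ acts on $\mathcal I(X)$ by $(W,Q)\mapsto WQW^{-1}$ and on $\mathcal G(X)$ by $(W,E)\mapsto W(E)$; denote the stabilizers by $GL(X)^Q$ and $GL(X)^E$. Let $\kappa:\mathcal I(X)\to\mathcal G(X)$, $\kappa(Q)=Q(X)$. If $H$ is one of these stabilizers, $GL(X)/H$ carries the quotient topology and the manifold structure for which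 the quotient map $GL(X)\to GL(X)/H$ is an analytic submersion; such a structure exists. The set $\mathcal I(X)$ is a submanifold of $\mathcal L(X)$. With the induced manifold structure on $\mathcal I(X)$ the following hold for all $Q\in\mathcal I(X)$ and $E\in\mathcal G(X)$. 1. $GL(X)^Q$ and $GL(X)^E$ are analytic Banach Lie subgroups of $GL(X)$, that is, with the subspace topology they are submanifolds of $GL(X)$ with analytic group operations. 2. The orbits of $Q$ and of $E$ are open and closed in $\mathcal I(X)$ and in $\mathcal G(X)$, respectively. 3. The maps $\Sigma_Q:GL(X)/GL(X)^Q\to\mathcal I(X)$, $[W]\mapsto WQW^{-1}$, and $\Sigma^E:GL(X)/GL(X)^E\to\mathcal G(X)$, $[W]\mapsto W(E)$, are bi-analytic bijections onto the orbits of $Q$ and $E$, respectively. 4. Let $R\subseteq\mathcal I(X)$ contain exactly one point of each orbit (such sets exist). Then the maps $\Sigma_Q$, $Q\in R$, together define a bi-analytic bijection from the disjoint union $\bigsqcup_{Q\in R}GL(X)/GL(X)^Q$ onto $\mathcal I(X)$. Likewise, if $R\subseteq\mathcal G(X)$ contains exactly one point of each orbit (such sets exist), the maps $\Sigma^E$,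 $E\in R$, together define a bi-analytic bijection from $\bigsqcup_{E\in R}GL(X)/GL(X)^E$ onto $\mathcal G(X)$. 5. The assignment $\upsilon_0:[W]\mapsto[W]$ is a well-defined analytic map from $GL(X)/GL(X)^Q$ to $GL(X)/GL(X)^{Q(X)}$, and $\kappa\circ\Sigma_Q=\Sigma^{Q(X)}\circ\upsilon_0$. -/

import Mathlib

open Set Topology

universe w u

noncomputable section

namespace BanachHomog

/-! ### Analytic Banach manifolds

The charts of a Banach manifold may take values in different (possibly non-isomorphic) Banach
spaces, so an analytic structure is an atlas whose charts carry their own model spaces. -/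

/-- A (Hausdorff) analytic Banach manifold structure over `𝕜` on a topological space `M`: an
atlas of homeomorphisms from open subsets of `M` onto open subsets of Banach spaces, with analytic
coordinate changes. -/
structure BanachStructure (𝕜 : Type w) [NontriviallyNormedField 𝕜] (M : Type u)
    [TopologicalSpace M] where
  Index : Type u
  Model : Index → Type u
  [normed : ∀ i, NormedAddCommGroup (Model i)]
  [space : ∀ i, NormedSpace 𝕜 (Model i)]
  [complete : ∀ i, CompleteSpace (Model i)]
  chart : ∀ i, OpenPartialHomeomorph M (Model i)
  exists_mem_source : ∀ x, ∃ i, x ∈ (chart i).source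
  analytic_trans : ∀ i j,
    AnalyticOnNhd 𝕜 (chart j ∘ (chart i).symm) ((chart i).symm.trans (chart j)).source
  hausdorff : T2Space M

attribute [instance] BanachStructure.normed BanachStructure.space BanachStructure.complete

namespace BanachStructure

variable {𝕜 : Type w} [NontriviallyNormedField 𝕜]

section maps

variable {M N : Type u} [TopologicalSpace M] [TopologicalSpace N]

/-- The local representative of a map with respect to a chart of the source and a chart of the
target. -/
def localRep (A : BanachStructure 𝕜 M) (B : BanachStructure 𝕜 N) (f : M → N)
    (i : A.Index) (j : B.Index) : A.Model i → B.Model j :=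
  B.chart j ∘ f ∘ (A.chart i).symm

/-- A map between Banach manifolds is analytic at `x` if it is continuous at `x` and its local
representatives around `x` are analytic (have local power series expansions). -/
def IsAnalyticAt (A : BanachStructure 𝕜 M) (B : BanachStructure 𝕜 N) (f : M → N) (x : M) :
    Prop :=
  ContinuousAt f x ∧ ∀ i j, x ∈ (A.chart i).source → f x ∈ (B.chart j).source →
    AnalyticAt 𝕜 (localRep A B f i j) (A.chart i x)

def IsAnalytic (A : BanachStructure 𝕜 M) (B : BanachStructure 𝕜 N) (f : M → N) : Prop :=
  ∀ x, IsAnalyticAt A B f x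

/-- An analytic immersion: an analytic map all of whose derivatives are injective with closed
complemented range, i.e. have a continuous linear left inverse. -/
def IsImmersion (A : BanachStructure 𝕜 M) (B : BanachStructure 𝕜 N) (f : M → N) : Prop :=
  IsAnalytic A B f ∧ ∀ x i j, x ∈ (A.chart i).source → f x ∈ (B.chart j).source →
    (fderiv 𝕜 (localRep A B f i j) (A.chart i x)).HasLeftInverse

/-- An analytic submersion: an analytic map all of whose derivatives are surjective with
complemented kernel, i.e. have a continuous linear right inverse. -/
def IsSubmersion (A : BanachStructure 𝕜 M) (B : BanachStructure 𝕜 N) (f : M → N) : Prop :=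
  IsAnalytic A B f ∧ ∀ x i j, x ∈ (A.chart i).source → f x ∈ (B.chart j).source →
    (fderiv 𝕜 (localRep A B f i j) (A.chart i x)).HasRightInverse

/-- `f` is a bi-analytic bijection from `M` onto the open submanifold `U` of `N`. -/
def IsBianalyticOnto (A : BanachStructure 𝕜 M) (B : BanachStructure 𝕜 N) (f : M → N)
    (U : Set N) : Prop :=
  IsOpen U ∧ range f = U ∧ IsAnalytic A B f ∧
    ∃ g : N → M, Function.LeftInverse g f ∧ ∀ y ∈ U, IsAnalyticAt B A g y

end maps

/-- An open subset of a Banach space (given by an open embedding) as a Banach manifold, with the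
embedding as the only chart. -/
def ofIsOpenEmbedding {M V : Type u} [TopologicalSpace M] [Nonempty M] [NormedAddCommGroup V]
    [NormedSpace 𝕜 V] [CompleteSpace V] (f : M → V) (hf : IsOpenEmbedding f) :
    BanachStructure 𝕜 M where
  Index := PUnit
  Model := fun _ => V
  chart := fun _ => hf.toOpenPartialHomeomorph f
  exists_mem_source := fun x => ⟨⟨⟩, by simp⟩
  analytic_trans := by
    intro i j x hx
    refine (analyticAt_id (𝕜 := 𝕜) (z := x)).congr ?_
    have hx' : x ∈ (hf.toOpenPartialHomeomorph f).target := by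
      simp only [OpenPartialHomeomorph.trans_source, OpenPartialHomeomorph.symm_source] at hx
      exact hx.1
    filter_upwards [(hf.toOpenPartialHomeomorph f).open_target.mem_nhds hx'] with y hy
    exact ((hf.toOpenPartialHomeomorph f).right_inv hy).symm
  hausdorff := hf.toIsEmbedding.t2Space

/-- A Banach space as a Banach manifold. -/
def self (V : Type u) [NormedAddCommGroup V] [NormedSpace 𝕜 V] [CompleteSpace V] :
    BanachStructure 𝕜 V :=
  ofIsOpenEmbedding id IsOpenEmbedding.id

/-- The product of two Banach manifolds. -/
def prod {M N : Type u} [TopologicalSpace M] [TopologicalSpace N] (A : BanachStructure 𝕜 M)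
    (B : BanachStructure 𝕜 N) : BanachStructure 𝕜 (M × N) where
  Index := A.Index × B.Index
  Model := fun i => A.Model i.1 × B.Model i.2
  chart := fun i => (A.chart i.1).prod (B.chart i.2)
  exists_mem_source := fun x => by
    obtain ⟨i, hi⟩ := A.exists_mem_source x.1
    obtain ⟨j, hj⟩ := B.exists_mem_source x.2
    exact ⟨(i, j), hi, hj⟩
  analytic_trans := by
    rintro ⟨i, i'⟩ ⟨j, j'⟩ ⟨x, y⟩ h
    have hx : x ∈ ((A.chart i).symm.trans (A.chart j)).source := ⟨h.1.1, h.2.1⟩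
    have hy : y ∈ ((B.chart i').symm.trans (B.chart j')).source := ⟨h.1.2, h.2.2⟩
    exact ((A.analytic_trans i j x hx).comp_of_eq analyticAt_fst rfl).prod
      ((B.analytic_trans i' j' y hy).comp_of_eq analyticAt_snd rfl)
  hausdorff := by
    have := A.hausdorff
    have := B.hausdorff
    infer_instance

/-- The disjoint union of a family of Banach manifolds. -/
def sigma {I : Type u} {M : I → Type u} [∀ k, TopologicalSpace (M k)]
    (A : ∀ k, BanachStructure 𝕜 (M k)) : BanachStructure 𝕜 (Σ k, M k) where
  Index := Σ k, (A k).Index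
  Model := fun i => (A i.1).Model i.2
  chart := fun i => ((A i.1).chart i.2).lift_openEmbedding IsOpenEmbedding.sigmaMk
  exists_mem_source := by
    rintro ⟨k, x⟩
    obtain ⟨i, hi⟩ := (A k).exists_mem_source x
    exact ⟨⟨k, i⟩, ⟨x, hi, rfl⟩⟩
  analytic_trans := by
    rintro ⟨k, i⟩ ⟨l, j⟩ x ⟨hx, ⟨z, hz, hzx⟩⟩
    obtain rfl : l = k := congrArg Sigma.fst hzx
    have hzx' : z = ((A l).chart i).symm x := by
      simpa using hzx
    have h := (A l).analytic_trans i j x ⟨hx, by simpa [← hzx'] using hz⟩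
    refine h.congr (Filter.Eventually.of_forall fun y => ?_)
    exact (OpenPartialHomeomorph.lift_openEmbedding_apply _ IsOpenEmbedding.sigmaMk).symm
  hausdorff := by
    have := fun k => (A k).hausdorff
    infer_instance

end BanachStructure

/-! ### The general linear group, its Lie subgroups and homogeneous spaces -/

section GeneralLinear

variable (𝕜 : Type w) [NontriviallyNormedField 𝕜] (X : Type u) [NormedAddCommGroup X]
  [NormedSpace 𝕜 X]

/-- The group of invertible bounded operators on `X`, with the norm topology. -/
abbrev BanachGL : Type u := (X →L[𝕜] X)ˣ

/-- The Banach manifold structure of `GL X` as an open subset of the Banach algebra of bounded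
operators on `X`. -/
def glStructure [CompleteSpace X] : BanachStructure 𝕜 (BanachGL 𝕜 X) :=
  BanachStructure.ofIsOpenEmbedding Units.val Units.isOpenEmbedding_val

variable {𝕜 X} [CompleteSpace X]

/-- `H` is an analytic Banach Lie subgroup of `GL X`: with the subspace topology, `H` is a (split)
analytic submanifold of `GL X` for which the group operations are analytic. -/
def IsBanachLieSubgroup (H : Subgroup (BanachGL 𝕜 X)) : Prop :=
  ∃ A : BanachStructure 𝕜 H,
    A.IsImmersion (glStructure 𝕜 X) (fun W : H => (W : BanachGL 𝕜 X)) ∧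
    (A.prod A).IsAnalytic A (fun p : H × H => p.1 * p.2) ∧
    A.IsAnalytic A (fun W : H => W⁻¹)

/-- `A` is the manifold structure of the homogeneous space `GL X ⧸ H` (with the quotient
topology): the quotient map is an analytic submersion. -/
def IsHomogeneousStructure (H : Subgroup (BanachGL 𝕜 X)) (A : BanachStructure 𝕜 (BanachGL 𝕜 X ⧸ H)) : Prop :=
  (glStructure 𝕜 X).IsSubmersion A (fun W : BanachGL 𝕜 X => (W : BanachGL 𝕜 X ⧸ H))

end GeneralLinear

/-! ### The space of non-trivial idempotents -/

section Idem

variable (𝕜 : Type w) [NontriviallyNormedField 𝕜] (X : Type u) [NormedAddCommGroup X]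
  [NormedSpace 𝕜 X]

/-- Bounded idempotents on `X` other than `0` and the identity. -/
def Idem : Type u := {Q : X →L[𝕜] X // Q * Q = Q ∧ Q ≠ 0 ∧ Q ≠ 1}

/-- The norm topology. -/
instance : TopologicalSpace (Idem 𝕜 X) := instTopologicalSpaceSubtype

variable {𝕜 X}

/-- The action of `GL X` by conjugation. -/
instance : MulAction (BanachGL 𝕜 X) (Idem 𝕜 X) where
  smul W Q := ⟨W * Q.1 * (W⁻¹ : BanachGL 𝕜 X), by
    obtain ⟨Q, h, h0, h1⟩ := Q
    refine ⟨?_, ?_, ?_⟩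
    · calc (W * Q * (W⁻¹ : BanachGL 𝕜 X) : X →L[𝕜] X) * (W * Q * (W⁻¹ : BanachGL 𝕜 X))
          = W * (Q * Q) * (W⁻¹ : BanachGL 𝕜 X) := by simp [mul_assoc]
        _ = W * Q * (W⁻¹ : BanachGL 𝕜 X) := congrArg (fun T => W.val * T * (W⁻¹ : BanachGL 𝕜 X).val) h
    · intro hW
      apply h0
      calc Q = (W⁻¹ : BanachGL 𝕜 X) * (W * Q * (W⁻¹ : BanachGL 𝕜 X)) * W := by simp [mul_assoc]
        _ = 0 := by simp [hW]
    · intro hW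
      apply h1
      calc Q = (W⁻¹ : BanachGL 𝕜 X) * (W * Q * (W⁻¹ : BanachGL 𝕜 X)) * W := by simp [mul_assoc]
        _ = 1 := by simp [hW]⟩
  one_smul Q := Subtype.ext (by change ((1 : BanachGL 𝕜 X) * Q.1 * ((1 : BanachGL 𝕜 X)⁻¹ : BanachGL 𝕜 X) : X →L[𝕜] X) = _; simp)
  mul_smul V W Q := Subtype.ext (by
    change ((V * W : BanachGL 𝕜 X) * Q.1 * ((V * W)⁻¹ : BanachGL 𝕜 X) : X →L[𝕜] X) =
      V * (W * Q.1 * (W⁻¹ : BanachGL 𝕜 X)) * (V⁻¹ : BanachGL 𝕜 X)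
    simp [mul_assoc])

/-- `A` is the manifold structure on the set of idempotents as a (split) submanifold of the Banach
space of bounded operators: the inclusion is an analytic immersion (it is a topological embedding
by the choice of the topology). -/
def IsSubmanifoldStructure [CompleteSpace X] (A : BanachStructure 𝕜 (Idem 𝕜 X)) : Prop :=
  A.IsImmersion (BanachStructure.self (X →L[𝕜] X)) (fun Q : Idem 𝕜 X => Q.1)

end Idem

/-! ### The Grassmann manifold -/

section Grassmann

variable (𝕜 : Type w) [NontriviallyNormedField 𝕜] (X : Type u) [NormedAddCommGroup X]
  [NormedSpace 𝕜 X]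

/-- Non-zero proper (topologically) complemented subspaces of `X`. -/
def Grassmannian : Type u :=
  {E : Submodule 𝕜 X // E ≠ ⊥ ∧ E ≠ ⊤ ∧ E.ClosedComplemented}

variable {𝕜 X}

/-- The action of `GL X` by `W • E = W(E)`. -/
instance : MulAction (BanachGL 𝕜 X) (Grassmannian 𝕜 X) where
  smul W E := ⟨E.1.map (W : X →L[𝕜] X).toLinearMap, by
    obtain ⟨E, h0, h1, f, hf⟩ := E
    have hinv : ∀ x : X, (W⁻¹ : BanachGL 𝕜 X).val (W.val x) = x := fun x => by
      change ((W⁻¹ : BanachGL 𝕜 X).val * W.val) x = x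
      simp
    have hinv' : ∀ x : X, W.val ((W⁻¹ : BanachGL 𝕜 X).val x) = x := fun x => by
      change (W.val * (W⁻¹ : BanachGL 𝕜 X).val) x = x
      simp
    refine ⟨?_, ?_, ?_⟩
    · intro h
      apply h0
      rw [Submodule.eq_bot_iff] at h ⊢
      intro x hx
      have := h _ (Submodule.mem_map_of_mem hx)
      rw [← hinv x]
      change W.val x = 0 at this
      rw [this, map_zero]
    · intro h
      apply h1
      rw [Submodule.eq_top_iff'] at h ⊢
      intro x
      obtain ⟨y, hy, hyx⟩ := h (W.val x)
      change W.val y = W.val x at hyx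
      rw [← hinv x, ← hyx, hinv]
      exact hy
    · refine ⟨(W.val ∘L E.subtypeL ∘L f ∘L (W⁻¹ : BanachGL 𝕜 X).val).codRestrict _
        (fun x => Submodule.mem_map_of_mem (f _).2), ?_⟩
      rintro ⟨_, y, hy, rfl⟩
      apply Subtype.ext
      change W.val (f ((W⁻¹ : BanachGL 𝕜 X).val (W.val y))) = W.val y
      rw [hinv, hf ⟨y, hy⟩]⟩
  one_smul E := Subtype.ext (Submodule.map_id _)
  mul_smul V W E := Subtype.ext (Submodule.map_comp _ _ _)

/-- The range map from idempotents to complemented subspaces. -/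
def kappa (Q : Idem 𝕜 X) : Grassmannian 𝕜 X :=
  ⟨Q.1.toLinearMap.range, by
    obtain ⟨Q, h, h0, h1⟩ := Q
    have hQ : ∀ x, Q (Q x) = Q x := fun x => congrArg (fun T : X →L[𝕜] X => T x) h
    refine ⟨?_, ?_, ?_⟩
    · intro hb
      apply h0
      ext x
      have : Q x ∈ Q.toLinearMap.range := ⟨x, rfl⟩
      rw [hb] at this
      simpa using this
    · intro ht
      apply h1
      ext x
      have : x ∈ Q.toLinearMap.range := ht ▸ Submodule.mem_top
      obtain ⟨y, rfl⟩ := this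
      exact hQ y
    · refine ⟨Q.codRestrict _ fun x => ⟨x, rfl⟩, ?_⟩
      rintro ⟨_, y, rfl⟩
      exact Subtype.ext (hQ y)⟩

/-- The graph `(I + T)(E)` of an operator `T : E → F` in `X`. -/
def graph {E F : Submodule 𝕜 X} (T : E →L[𝕜] F) : Submodule 𝕜 X :=
  (E.subtypeL + F.subtypeL ∘L T).toLinearMap.range

theorem mem_graph {E F : Submodule 𝕜 X} {T : E →L[𝕜] F} {x : X} :
    x ∈ graph T ↔ ∃ e : E, (e : X) + T e = x := Iff.rfl

theorem isTopCompl_graph {E F : Submodule 𝕜 X} (h : E.IsTopCompl F) (T : E →L[𝕜] F) :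
    (graph T).IsTopCompl F := by
  have key : ∀ e : E, E.projectionOntoL F h ((e : X) + T e) = e := fun e => by simp
  have hp := ContinuousLinearMap.isTopCompl_of_proj (p := graph T)
    (f := ((E.subtypeL + F.subtypeL ∘L T) ∘L E.projectionOntoL F h).codRestrict (graph T)
      fun x => ⟨_, rfl⟩) (by
        rintro ⟨_, e, rfl⟩
        apply Subtype.ext
        change ((E.projectionOntoL F h ((e : X) + T e) : E) : X) +
          T (E.projectionOntoL F h ((e : X) + T e)) = (e : X) + T e
        rw [key])
  refine (congrArg (Submodule.IsTopCompl (graph T)) ?_).mp hp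
  ext x
  rw [← Submodule.projectionOntoL_apply_eq_zero_iff h, LinearMap.mem_ker]
  symm
  constructor
  · intro hx
    apply Subtype.ext
    change ((E.projectionOntoL F h x : E) : X) + T (E.projectionOntoL F h x) = 0
    rw [hx]; simp
  · intro hx
    have hx' : ((E.projectionOntoL F h x : E) : X) + T (E.projectionOntoL F h x) = 0 :=
      congrArg Subtype.val hx
    rw [← key (E.projectionOntoL F h x), hx', map_zero]

/-- The pairs `(E, F)` of complementary elements of the Grassmannian. -/
abbrev ComplPair (𝕜 : Type w) [NontriviallyNormedField 𝕜] (X : Type u) [NormedAddCommGroup X]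
    [NormedSpace 𝕜 X] : Type u :=
  {p : Grassmannian 𝕜 X × Grassmannian 𝕜 X // IsCompl p.1.1 p.2.1}

theorem exists_complPair (E : Grassmannian 𝕜 X) : ∃ i : ComplPair 𝕜 X, i.1.1 = E := by
  have hc := E.2.2.2.isTopCompl_complement
  refine ⟨⟨(E, ⟨E.2.2.2.complement, ?_, ?_, hc.symm.closedComplemented⟩), hc.isCompl⟩, rfl⟩
  · intro h
    have := hc.isCompl.sup_eq_top
    rw [h] at this
    exact E.2.2.1 (by simpa using this)
  · intro h
    have := hc.isCompl.inf_eq_bot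
    rw [h] at this
    exact E.2.1 (by simpa using this)

variable [CompleteSpace X]

theorem Grassmannian.isTopCompl {E F : Grassmannian 𝕜 X} (h : IsCompl E.1 F.1) :
    E.1.IsTopCompl F.1 :=
  Submodule.IsCompl.isTopCompl_of_isClosed h E.2.2.2.isClosed F.2.2.2.isClosed

instance (E : Grassmannian 𝕜 X) : CompleteSpace E.1 := E.2.2.2.isClosed.completeSpace_coe

/-- The parametrization `T ↦ (I + T)(E)` of the set of complements of `F` by operators `E → F`. -/
def param (i : ComplPair 𝕜 X) (T : i.1.1.1 →L[𝕜] i.1.2.1) : Grassmannian 𝕜 X :=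
  ⟨graph T, by
    obtain ⟨⟨E, F⟩, h⟩ := i
    have hc := (isTopCompl_graph (Grassmannian.isTopCompl h) T)
    refine ⟨?_, ?_, hc.closedComplemented⟩
    · intro hb
      have := hc.isCompl
      rw [hb] at this
      exact F.2.2.1 (by simpa using this.sup_eq_top)
    · intro ht
      have := hc.isCompl
      rw [ht] at this
      exact F.2.1 (by simpa using this.inf_eq_bot)⟩

open Classical in
/-- The coordinate map, defined on the complements `G` of `F`: the operator `T : E → F` with
`(I + T)(E) = G`, i.e. minus the restriction to `E` of the projection onto `F` along `G`. -/
def coord (i : ComplPair 𝕜 X) (G : Grassmannian 𝕜 X) : i.1.1.1 →L[𝕜] i.1.2.1 :=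
  if h : IsCompl G.1 i.1.2.1 then
    -((i.1.2.1).projectionOntoL G.1 (Grassmannian.isTopCompl h).symm ∘L (i.1.1.1).subtypeL)
  else 0

theorem isCompl_param (i : ComplPair 𝕜 X) (T : i.1.1.1 →L[𝕜] i.1.2.1) :
    IsCompl (param i T).1 i.1.2.1 :=
  (isTopCompl_graph (Grassmannian.isTopCompl i.2) T).isCompl

theorem coord_eq (i : ComplPair 𝕜 X) {G : Grassmannian 𝕜 X} (h : IsCompl G.1 i.1.2.1)
    (S : i.1.1.1 →L[𝕜] i.1.2.1) (hS : ∀ e : i.1.1.1, (e : X) + S e ∈ G.1) : coord i G = S := by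
  have hG := (Grassmannian.isTopCompl h).symm
  ext1 e
  have h0 := (Submodule.projectionOntoL_apply_eq_zero_iff hG).2 (hS e)
  rw [map_add, Submodule.projectionOntoL_apply_left hG] at h0
  rw [coord, dif_pos h]
  exact (eq_neg_of_add_eq_zero_right h0).symm

theorem add_coord_mem (i : ComplPair 𝕜 X) {G : Grassmannian 𝕜 X} (h : IsCompl G.1 i.1.2.1)
    (e : i.1.1.1) : (e : X) + coord i G e ∈ G.1 := by
  have hG := (Grassmannian.isTopCompl h).symm
  rw [← Submodule.projectionOntoL_apply_eq_zero_iff hG, map_add, Submodule.projectionOntoL_apply_left hG, coord,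
    dif_pos h]
  exact add_neg_cancel _

theorem param_coord (i : ComplPair 𝕜 X) {G : Grassmannian 𝕜 X} (h : IsCompl G.1 i.1.2.1) :
    param i (coord i G) = G := by
  have hle : (param i (coord i G)).1 ≤ G.1 := by
    rintro _ ⟨e, rfl⟩
    exact add_coord_mem i h e
  refine Subtype.ext (eq_of_le_of_inf_le_of_sup_le (z := i.1.2.1) hle ?_ ?_)
  · rw [h.inf_eq_bot]; exact bot_le
  · rw [(isCompl_param i _).sup_eq_top]; exact le_top

/-- The manifold topology of the Grassmannian: the final topology of the parametrizations. -/
instance : TopologicalSpace (Grassmannian 𝕜 X) :=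
  ⨆ i : ComplPair 𝕜 X, TopologicalSpace.coinduced (param i) inferInstance

theorem isOpen_iff {U : Set (Grassmannian 𝕜 X)} :
    IsOpen U ↔ ∀ i : ComplPair 𝕜 X, IsOpen (param i ⁻¹' U) := by
  rw [isOpen_iSup_iff]
  rfl

theorem continuous_param (i : ComplPair 𝕜 X) : Continuous (param i) :=
  continuous_def.2 fun _ hU => isOpen_iff.1 hU i

/-- The operator comparing the parametrizations `i` and `j`: `T ↦ P (I + T)`, with `P` the
projection onto the first member of `j` along the second one. -/
def compar (i j : ComplPair 𝕜 X) (T : i.1.1.1 →L[𝕜] i.1.2.1) : i.1.1.1 →L[𝕜] j.1.1.1 :=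
  (j.1.1.1).projectionOntoL j.1.2.1 (Grassmannian.isTopCompl j.2) ∘L
    ((i.1.1.1).subtypeL + (i.1.2.1).subtypeL ∘L T)

/-- The expression for the coordinate change from `i` to `j`. -/
def coordChange (i j : ComplPair 𝕜 X) (T : i.1.1.1 →L[𝕜] i.1.2.1) : j.1.1.1 →L[𝕜] j.1.2.1 :=
  ((j.1.2.1).projectionOntoL j.1.1.1 (Grassmannian.isTopCompl j.2).symm ∘L
    ((i.1.1.1).subtypeL + (i.1.2.1).subtypeL ∘L T)) ∘L (compar i j T).inverse

theorem analyticAt_coordChange (i j : ComplPair 𝕜 X) {T : i.1.1.1 →L[𝕜] i.1.2.1}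
    (hT : (compar i j T).IsInvertible) : AnalyticAt 𝕜 (coordChange i j) T := by
  apply ContDiffAt.analyticAt
  have h1 : ContDiff 𝕜 ⊤ (compar i j) := by unfold compar; fun_prop
  have h2 : ContDiffAt 𝕜 ⊤ (fun T => (compar i j T).inverse) T :=
    (hT.contDiffAt_map_inverse).comp T h1.contDiffAt
  unfold coordChange
  exact ContDiffAt.clm_comp (by fun_prop) h2

theorem isCompl_param_iff (i j : ComplPair 𝕜 X) (T : i.1.1.1 →L[𝕜] i.1.2.1) :
    IsCompl (param i T).1 j.1.2.1 ↔ (compar i j T).IsInvertible := by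
  have hi := Grassmannian.isTopCompl i.2
  have hj := Grassmannian.isTopCompl j.2
  have key : ∀ e : i.1.1.1, (i.1.1.1).projectionOntoL i.1.2.1 hi ((e : X) + T e) = e :=
    fun e => by simp
  have hA : ∀ e, compar i j T e = (j.1.1.1).projectionOntoL j.1.2.1 hj ((e : X) + T e) :=
    fun _ => rfl
  have hker : ∀ e, compar i j T e = 0 ↔ (e : X) + T e ∈ j.1.2.1 := fun e => by
    rw [hA, Submodule.projectionOntoL_apply_eq_zero_iff hj]
  constructor
  · intro h
    have hinj : Function.Injective (compar i j T) := by
      rw [injective_iff_map_eq_zero]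
      intro e he
      have h0 : (e : X) + T e = 0 :=
        Submodule.disjoint_def.1 h.disjoint _ ⟨e, rfl⟩ ((hker e).1 he)
      rw [← key e, h0, map_zero]
    have hsurj : Function.Surjective (compar i j T) := by
      intro x
      obtain ⟨g, hg, f, hf, hx⟩ := Submodule.mem_sup.1
        (show (x : X) ∈ (param i T).1 ⊔ j.1.2.1 by rw [h.sup_eq_top]; exact Submodule.mem_top)
      obtain ⟨e, rfl⟩ := hg
      refine ⟨e, ?_⟩
      have hf0 := (Submodule.projectionOntoL_apply_eq_zero_iff hj).2 hf
      have := congrArg ((j.1.1.1).projectionOntoL j.1.2.1 hj) hx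
      rw [map_add, hf0, add_zero, Submodule.projectionOntoL_apply_left hj] at this
      exact this
    exact ⟨ContinuousLinearEquiv.ofBijective (compar i j T) (LinearMap.ker_eq_bot.2 hinj)
      (LinearMap.range_eq_top.2 hsurj), ContinuousLinearEquiv.coe_ofBijective _ _ _⟩
  · rintro ⟨A, hAe⟩
    have hAe' : ∀ e, A e = compar i j T e := fun e => by rw [← hAe]; rfl
    constructor
    · rw [Submodule.disjoint_def]
      rintro _ ⟨e, rfl⟩ hx
      have he : A e = 0 := by rw [hAe']; exact (hker e).2 hx
      have : e = 0 := by simpa using he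
      subst this
      simp
    · rw [codisjoint_iff, eq_top_iff]
      intro x _
      set e := A.symm ((j.1.1.1).projectionOntoL j.1.2.1 hj x) with he
      have h1 : compar i j T e = (j.1.1.1).projectionOntoL j.1.2.1 hj x := by
        rw [← hAe', he, A.apply_symm_apply]
      refine Submodule.mem_sup.2 ⟨(e : X) + T e, ⟨e, rfl⟩, x - ((e : X) + T e), ?_, by abel⟩
      rw [← Submodule.projectionOntoL_apply_eq_zero_iff hj, map_sub, ← hA, h1, sub_self]

theorem coord_param (i j : ComplPair 𝕜 X) {T : i.1.1.1 →L[𝕜] i.1.2.1}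
    (hT : (compar i j T).IsInvertible) : coord j (param i T) = coordChange i j T := by
  have hj := Grassmannian.isTopCompl j.2
  refine coord_eq j ((isCompl_param_iff i j T).2 hT) _ fun x => ?_
  obtain ⟨A, hA⟩ := hT
  have hAe : ∀ e, A e = compar i j T e := fun e => by rw [← hA]; rfl
  refine ⟨A.symm x, ?_⟩
  have h1 : (j.1.1.1).projectionOntoL j.1.2.1 hj ((A.symm x : X) + T (A.symm x)) = x :=
    (hAe _).symm.trans (A.apply_symm_apply x)
  have h2 : coordChange i j T x = (j.1.2.1).projectionOntoL j.1.1.1 hj.symm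
      ((A.symm x : X) + T (A.symm x)) := by
    simp only [coordChange, ← hA, ContinuousLinearMap.inverse_equiv]
    rfl
  have h3 := Submodule.projectionL_add_projectionL_eq_self hj ((A.symm x : X) + T (A.symm x))
  rw [h2]
  exact h3.symm.trans (congrArg (fun y : j.1.1.1 =>
    (y : X) + _) h1)

theorem isOpen_invertible (i j : ComplPair 𝕜 X) :
    IsOpen {T : i.1.1.1 →L[𝕜] i.1.2.1 | (compar i j T).IsInvertible} := by
  have h1 : Continuous (compar i j) := by unfold compar; fun_prop
  exact (ContinuousLinearEquiv.isOpen (𝕜 := 𝕜) (E := i.1.1.1) (F := j.1.1.1)).preimage h1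

/-- The chart of the Grassmannian attached to a pair `(E, F)` of complementary subspaces: its
domain is the set of complements of `F`, and it takes values in the space of operators `E → F`. -/
def grassmannChart (i : ComplPair 𝕜 X) :
    OpenPartialHomeomorph (Grassmannian 𝕜 X) (i.1.1.1 →L[𝕜] i.1.2.1) where
  toFun := coord i
  invFun := param i
  source := {G | IsCompl G.1 i.1.2.1}
  target := univ
  map_source' _ _ := mem_univ _
  map_target' T _ := isCompl_param i T
  left_inv' _ h := param_coord i h
  right_inv' T _ := coord_eq i (isCompl_param i T) T fun e => ⟨e, rfl⟩
  open_source := isOpen_iff.2 fun k => by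
    simpa only [preimage_ofPred_eq, isCompl_param_iff] using isOpen_invertible k i
  open_target := isOpen_univ
  continuousOn_toFun := by
    have hs : IsOpen {G : Grassmannian 𝕜 X | IsCompl G.1 i.1.2.1} := isOpen_iff.2 fun k => by
      simpa only [preimage_ofPred_eq, isCompl_param_iff] using isOpen_invertible k i
    rw [continuousOn_open_iff hs]
    intro V hV
    refine isOpen_iff.2 fun k => ?_
    have hc : ContinuousOn (coordChange k i)
        {T | (compar k i T).IsInvertible} := fun T hT =>
      (analyticAt_coordChange k i hT).continuousAt.continuousWithinAt
    convert hc.isOpen_inter_preimage (isOpen_invertible k i) hV using 1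
    ext T
    simp only [mem_preimage, mem_inter_iff, mem_ofPred_eq, isCompl_param_iff]
    refine and_congr_right fun hT => ?_
    rw [coord_param k i hT]
  continuousOn_invFun := (continuous_param i).continuousOn

theorem t2Space_grassmannian : T2Space (Grassmannian 𝕜 X) := by
  have main : ∀ E E' : Grassmannian 𝕜 X, ¬ E.1 ≤ E'.1 →
      ∃ U V : Set (Grassmannian 𝕜 X), IsOpen U ∧ IsOpen V ∧ E ∈ U ∧ E' ∈ V ∧ Disjoint U V := by
    intro E E' hE
    obtain ⟨x, hx, hx'⟩ := SetLike.not_le_iff_exists.1 hE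
    obtain ⟨i, rfl⟩ := exists_complPair E
    obtain ⟨j, rfl⟩ := exists_complPair E'
    have hj := Grassmannian.isTopCompl j.2
    let P := (j.1.1.1).projectionOntoL j.1.2.1 hj
    let R := (j.1.2.1).projectionOntoL j.1.1.1 hj.symm
    let Φ : (i.1.1.1 →L[𝕜] i.1.2.1) × (j.1.1.1 →L[𝕜] j.1.2.1) → j.1.2.1 := fun p =>
      R (x + p.1 ⟨x, hx⟩) - p.2 (P (x + p.1 ⟨x, hx⟩))
    have hΦ : Continuous Φ := by fun_prop
    have h0 : Φ (0, 0) ≠ 0 := by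
      intro h
      apply hx'
      rw [← Submodule.projectionOntoL_apply_eq_zero_iff hj.symm]
      have h' : R (x + 0) - 0 = 0 := h
      rw [add_zero, sub_zero] at h'
      exact h'
    obtain ⟨U, V, hU, hU0, hV, hV0, hUV⟩ := mem_nhds_prod_iff'.1
      ((isOpen_ne.preimage hΦ).mem_nhds (x := (0, 0)) h0)
    have self_mem : ∀ k : ComplPair 𝕜 X, param k 0 = k.1.1 := fun k => by
      apply Subtype.ext
      ext y
      refine ⟨?_, fun hy => ⟨⟨y, hy⟩, ?_⟩⟩
      · rintro ⟨e, rfl⟩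
        simp
      · simp
    refine ⟨param i '' U, param j '' V,
      (grassmannChart i).isOpen_image_symm_of_subset_target hU (subset_univ _),
      (grassmannChart j).isOpen_image_symm_of_subset_target hV (subset_univ _),
      ⟨0, hU0, self_mem i⟩, ⟨0, hV0, self_mem j⟩, ?_⟩
    rw [Set.disjoint_left]
    rintro _ ⟨T, hT, rfl⟩ ⟨S, hS, hST⟩
    have hmem : x + T ⟨x, hx⟩ ∈ (param j S).1 := by
      rw [hST]
      exact ⟨⟨x, hx⟩, rfl⟩
    obtain ⟨e, he⟩ := hmem
    change (e : X) + S e = x + T ⟨x, hx⟩ at he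
    apply hUV (mk_mem_prod hT hS)
    change R (x + T ⟨x, hx⟩) - S (P (x + T ⟨x, hx⟩)) = 0
    have hP : P ((e : X) + S e) = e := by simp [P]
    have hR : R ((e : X) + S e) = S e := by simp [R]
    rw [← he, hP, hR, sub_self]
  refine ⟨fun E E' hne => ?_⟩
  by_cases h : E.1 ≤ E'.1
  · have h' : ¬ E'.1 ≤ E.1 := fun h' => hne (Subtype.ext (le_antisymm h h'))
    obtain ⟨U, V, hU, hV, h1, h2, h3⟩ := main E' E h'
    exact ⟨V, U, hV, hU, h2, h1, h3.symm⟩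
  · exact main E E' h

variable (𝕜 X) in
/-- The Grassmann manifold of `X`. -/
def grassmannStructure : BanachStructure 𝕜 (Grassmannian 𝕜 X) where
  Index := ComplPair 𝕜 X
  Model := fun i => i.1.1.1 →L[𝕜] i.1.2.1
  chart := grassmannChart
  exists_mem_source := fun E => by
    obtain ⟨i, rfl⟩ := exists_complPair E
    exact ⟨i, i.2⟩
  analytic_trans := fun i j T hT => by
    have hT' : (compar i j T).IsInvertible := (isCompl_param_iff i j T).1 hT.2
    refine (analyticAt_coordChange i j hT').congr ?_
    filter_upwards [(isOpen_invertible i j).mem_nhds hT'] with S hS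
    exact (coord_param i j hS).symm
  hausdorff := t2Space_grassmannian

end Grassmann

/-! ### Disjoint unions of homogeneous spaces -/

/-- `R` contains exactly one point of each orbit of the action of `G` on `Y`. -/
def IsOrbitTransversal (G : Type u) {Y : Type u} [Group G] [MulAction G Y] (R : Set Y) : Prop :=
  ∀ y : Y, ∃! q : Y, q ∈ R ∧ y ∈ MulAction.orbit G q

end BanachHomog

end

open BanachHomog

/-!
All orbit maps `W ↦ W • y` in question are analytic submersions, because they have analytic local
sections. Near an idempotent `Q`, the operator `P * Q + (1 - P) * (1 - Q)` is invertible and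
conjugates `Q` to `P`. Near a subspace `E` with complement `F`, the shear `I + T` extending
`T : E → F` by zero on `F` moves `E` to the graph of `T`. By the inverse function theorem, a
submersion is open and admits analytic local sections through every point, which gives the
statements about orbits and quotients.

Local sections `s` also turn both the idempotents and the stabilizers into local analytic retracts
of `L(X)`: the retractions are `B ↦ W(B) Q W(B)⁻¹` with `W(B) = B * Q + (1 - B) * (1 - Q)`, and
`W ↦ s(W • y)⁻¹ * W`. An analytic retract is a submanifold by Cartan's linearization: for a
retraction `r` with derivative `p` at a fixed point, the map `Φ z = p (r z) + (1 - p) (z - r z)` is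
a local bi-analytic map with `Φ ∘ r = p ∘ Φ` near that point.
-/

namespace BanachHomog

open Filter

section InverseFunction

variable {𝕜 E F : Type*} [NontriviallyNormedField 𝕜] [NormedAddCommGroup E] [NormedSpace 𝕜 E]
  [NormedAddCommGroup F] [NormedSpace 𝕜 F] {f : E → F} {x : E}

theorem exists_analyticAt_inverse [CompleteSpace E] (hf : AnalyticAt 𝕜 f x) {f' : E ≃L[𝕜] F}
    (hf' : HasFDerivAt f (f' : E →L[𝕜] F) x) :
    ∃ g : F → E, AnalyticAt 𝕜 g (f x) ∧ (∀ᶠ y in 𝓝 x, g (f y) = y) ∧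
      ∀ᶠ z in 𝓝 (f x), f (g z) = z := by
  obtain ⟨p, hp⟩ := hf
  have hp1 : p 1 = (continuousMultilinearCurryFin1 𝕜 E F).symm f' := by
    rw [← hf'.fderiv, hp.fderiv_eq, LinearIsometryEquiv.symm_apply_apply]
  have hstrict : HasStrictFDerivAt f (f' : E →L[𝕜] F) x := by
    rw [← hf'.fderiv]
    exact AnalyticAt.hasStrictFDerivAt ⟨p, hp⟩
  have hg := (hstrict.toOpenPartialHomeomorph f).hasFPowerSeriesAt_symm
    hstrict.mem_toOpenPartialHomeomorph_source hp hp1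
  exact ⟨_, hg.analyticAt, hstrict.eventually_left_inverse, hstrict.eventually_right_inverse⟩

theorem exists_analyticAt_rightInverse [CompleteSpace F] (hf : AnalyticAt 𝕜 f x)
    (h : (fderiv 𝕜 f x).HasRightInverse) :
    ∃ g : F → E, AnalyticAt 𝕜 g (f x) ∧ g (f x) = x ∧ ∀ᶠ z in 𝓝 (f x), f (g z) = z := by
  obtain ⟨R, hR⟩ := h
  let s : F → E := fun z => x + R (z - f x)
  have hs : AnalyticAt 𝕜 s (f x) :=
    analyticAt_const.add ((R.analyticAt _).fun_comp (analyticAt_id.sub analyticAt_const))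
  have hsx : s (f x) = x := by simp [s]
  have hs' : HasFDerivAt s R (f x) := by
    simpa [s] using (R.hasFDerivAt.comp (f x) ((hasFDerivAt_id (f x)).sub_const (f x))).const_add x
  have hfs : AnalyticAt 𝕜 (f ∘ s) (f x) := hf.comp_of_eq hs hsx
  have hfs' : HasFDerivAt (f ∘ s) (ContinuousLinearEquiv.refl 𝕜 F : F →L[𝕜] F) (f x) := by
    rw [← hsx] at hf
    refine (hf.differentiableAt.hasFDerivAt.comp (f x) hs').congr_fderiv ?_
    rw [hsx]
    exact ContinuousLinearMap.ext hR
  obtain ⟨g, hg, hgf, hfg⟩ := exists_analyticAt_inverse hfs hfs'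
  have hfsx : (f ∘ s) (f x) = f x := congrArg f hsx
  rw [hfsx] at hg hfg
  have hgx : g (f x) = f x := by simpa [hsx] using hgf.self_of_nhds
  exact ⟨s ∘ g, hs.comp_of_eq hg hgx, by rw [Function.comp_apply, hgx, hsx], hfg⟩

theorem exists_analyticAt_leftInverse [CompleteSpace E] (hf : AnalyticAt 𝕜 f x)
    (h : (fderiv 𝕜 f x).HasLeftInverse) :
    ∃ g : F → E, AnalyticAt 𝕜 g (f x) ∧ ∀ᶠ y in 𝓝 x, g (f y) = y := by
  obtain ⟨L, hL⟩ := h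
  have hLf : HasFDerivAt (L ∘ f) (ContinuousLinearEquiv.refl 𝕜 E : E →L[𝕜] E) x :=
    (L.hasFDerivAt.comp x hf.differentiableAt.hasFDerivAt).congr_fderiv
      (ContinuousLinearMap.ext hL)
  obtain ⟨g, hg, hgf, -⟩ := exists_analyticAt_inverse ((L.analyticAt _).comp hf) hLf
  exact ⟨g ∘ L, hg.comp_of_eq (L.analyticAt (f x)) rfl, hgf⟩

end InverseFunction

namespace BanachStructure

variable {𝕜 : Type w} [NontriviallyNormedField 𝕜] {M N P : Type u} [TopologicalSpace M]
  [TopologicalSpace N] [TopologicalSpace P] {A : BanachStructure 𝕜 M} {B : BanachStructure 𝕜 N}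
  {C : BanachStructure 𝕜 P}

section AnalyticMaps

theorem localRep_apply (f : M → N) {x : M} {i : A.Index} (j : B.Index)
    (hi : x ∈ (A.chart i).source) : localRep A B f i j (A.chart i x) = B.chart j (f x) := by
  simp only [localRep, Function.comp_apply, (A.chart i).left_inv hi]

theorem localRep_congr {f g : M → N} {x : M} (h : f =ᶠ[𝓝 x] g) {i : A.Index} (j : B.Index)
    (hi : x ∈ (A.chart i).source) :
    localRep A B f i j =ᶠ[𝓝 (A.chart i x)] localRep A B g i j :=
  (h.comp_tendsto ((A.chart i).tendsto_symm hi)).fun_comp (B.chart j)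

theorem localRep_comp_eventuallyEq {f : M → N} (g : N → P) {x : M} (hf : ContinuousAt f x)
    {i : A.Index} {j : B.Index} (k : C.Index) (hi : x ∈ (A.chart i).source)
    (hj : f x ∈ (B.chart j).source) :
    localRep A C (g ∘ f) i k =ᶠ[𝓝 (A.chart i x)] localRep B C g j k ∘ localRep A B f i j := by
  have hfi := hf.tendsto.comp ((A.chart i).tendsto_symm hi)
  filter_upwards [hfi.eventually ((B.chart j).eventually_left_inverse hj)] with y hy
  exact congrArg (C.chart k ∘ g) hy.symm

theorem localRep_id_eventuallyEq {x : M} {i : A.Index} (hi : x ∈ (A.chart i).source) :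
    localRep A A id i i =ᶠ[𝓝 (A.chart i x)] id :=
  (A.chart i).eventually_right_inverse' hi

theorem analyticAt_localRep_id {x : M} {i j : A.Index} (hi : x ∈ (A.chart i).source)
    (hj : x ∈ (A.chart j).source) : AnalyticAt 𝕜 (localRep A A id i j) (A.chart i x) :=
  A.analytic_trans i j _
    ⟨(A.chart i).map_source hi, mem_preimage.2 (((A.chart i).left_inv hi).symm ▸ hj)⟩

theorem isAnalyticAt_of_chart {f : M → N} {x : M} (hf : ContinuousAt f x) {i : A.Index}
    {j : B.Index} (hi : x ∈ (A.chart i).source) (hj : f x ∈ (B.chart j).source)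
    (h : AnalyticAt 𝕜 (localRep A B f i j) (A.chart i x)) : IsAnalyticAt A B f x := by
  refine ⟨hf, fun k l hk hl => ?_⟩
  have htarget : AnalyticAt 𝕜 (localRep A B f i l) (A.chart i x) :=
    ((analyticAt_localRep_id hj hl).comp_of_eq h (localRep_apply f j hi)).congr
      (localRep_comp_eventuallyEq id hf l hi hj).symm
  exact (htarget.comp_of_eq (analyticAt_localRep_id hk hi) (localRep_apply id i hk)).congr
    (localRep_comp_eventuallyEq f continuousAt_id l hk hi).symm

theorem IsAnalyticAt.comp {f : M → N} {g : N → P} {x : M} (hg : IsAnalyticAt B C g (f x))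
    (hf : IsAnalyticAt A B f x) : IsAnalyticAt A C (g ∘ f) x := by
  obtain ⟨i, hi⟩ := A.exists_mem_source x
  obtain ⟨j, hj⟩ := B.exists_mem_source (f x)
  obtain ⟨k, hk⟩ := C.exists_mem_source (g (f x))
  exact isAnalyticAt_of_chart (hg.1.comp hf.1) hi hk
    (((hg.2 j k hj hk).comp_of_eq (hf.2 i j hi hj) (localRep_apply f j hi)).congr
      (localRep_comp_eventuallyEq g hf.1 k hi hj).symm)

theorem IsAnalyticAt.comp_of_eq {f : M → N} {g : N → P} {x : M} {y : N}
    (hg : IsAnalyticAt B C g y) (hf : IsAnalyticAt A B f x) (h : f x = y) :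
    IsAnalyticAt A C (g ∘ f) x := by
  subst h
  exact hg.comp hf

theorem IsAnalyticAt.congr {f g : M → N} {x : M} (hf : IsAnalyticAt A B f x)
    (h : f =ᶠ[𝓝 x] g) : IsAnalyticAt A B g x := by
  refine ⟨hf.1.congr h, fun i j hi hj => ?_⟩
  rw [← h.self_of_nhds] at hj
  exact (hf.2 i j hi hj).congr (localRep_congr h j hi)

end AnalyticMaps

section Self

variable {V W : Type u} [NormedAddCommGroup V] [NormedSpace 𝕜 V] [CompleteSpace V]
  [NormedAddCommGroup W] [NormedSpace 𝕜 W] [CompleteSpace W]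

theorem isAnalyticAt_chart {i : A.Index} {x : M} (hi : x ∈ (A.chart i).source) :
    IsAnalyticAt A (self (A.Model i)) (A.chart i) x :=
  ⟨(A.chart i).continuousAt hi, fun _ _ hk _ => analyticAt_localRep_id hk hi⟩

theorem self_chart_symm (i : (self (𝕜 := 𝕜) V).Index) :
    (((self (𝕜 := 𝕜) V).chart i).symm : V → V) = id :=
  funext fun _ => IsOpenEmbedding.id.toOpenPartialHomeomorph_left_inv (id : V → V)

theorem isAnalyticAt_chart_symm {i : A.Index} {y : A.Model i} (hy : y ∈ (A.chart i).target) :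
    IsAnalyticAt (self (A.Model i)) A (A.chart i).symm y := by
  refine ⟨(A.chart i).symm.continuousAt hy, fun k j _ hj => ?_⟩
  rw [localRep, self_chart_symm]
  exact A.analytic_trans i j y ⟨hy, hj⟩

theorem isAnalyticAt_self_iff_comp_symm {f : M → V} {x : M} {i : A.Index}
    (hi : x ∈ (A.chart i).source) :
    IsAnalyticAt A (self V) f x ↔ AnalyticAt 𝕜 (f ∘ (A.chart i).symm) (A.chart i x) := by
  refine ⟨fun h => h.2 i ⟨⟩ hi trivial, fun h => ?_⟩
  refine isAnalyticAt_of_chart (j := ⟨⟩) ?_ hi trivial h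
  have hf := h.continuousAt.comp ((A.chart i).continuousAt hi)
  exact hf.congr (((A.chart i).eventually_left_inverse hi).mono fun y hy => congrArg f hy)

theorem isAnalyticAt_self_iff {f : V → W} {x : V} :
    IsAnalyticAt (self (𝕜 := 𝕜) V) (self W) f x ↔ AnalyticAt 𝕜 f x := by
  obtain ⟨i, hi⟩ := (self (𝕜 := 𝕜) V).exists_mem_source x
  rw [isAnalyticAt_self_iff_comp_symm hi, self_chart_symm]
  rfl

theorem isAnalyticAt_of_eventuallyEq {f : M → N} {x : M} {i : A.Index} {j : B.Index}
    (hi : x ∈ (A.chart i).source) {φ : A.Model i → B.Model j}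
    (hφ : AnalyticAt 𝕜 φ (A.chart i x)) (hj : φ (A.chart i x) ∈ (B.chart j).target)
    (h : f =ᶠ[𝓝 x] fun y => (B.chart j).symm (φ (A.chart i y))) : IsAnalyticAt A B f x :=
  (((isAnalyticAt_chart_symm hj).comp (isAnalyticAt_self_iff.2 hφ)).comp
    (isAnalyticAt_chart hi)).congr h.symm

end Self

theorem IsAnalyticAt.mul {R : Type u} [NormedRing R] [NormedAlgebra 𝕜 R] [CompleteSpace R]
    {f g : M → R} {x : M} (hf : IsAnalyticAt A (self R) f x) (hg : IsAnalyticAt A (self R) g x) :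
    IsAnalyticAt A (self R) (fun y => f y * g y) x := by
  obtain ⟨i, hi⟩ := A.exists_mem_source x
  rw [isAnalyticAt_self_iff_comp_symm hi] at hf hg ⊢
  exact hf.mul hg

theorem isAnalyticAt_fst (x : M × N) : IsAnalyticAt (A.prod B) A Prod.fst x := by
  refine ⟨continuousAt_fst, fun i j hi hj => ?_⟩
  exact (analyticAt_localRep_id hi.1 hj).comp_of_eq analyticAt_fst rfl

theorem isAnalyticAt_snd (x : M × N) : IsAnalyticAt (A.prod B) B Prod.snd x := by
  refine ⟨continuousAt_snd, fun i j hi hj => ?_⟩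
  exact (analyticAt_localRep_id hi.2 hj).comp_of_eq analyticAt_snd rfl

section Comap

variable [Nonempty M] {f : M → N}

variable (B) in
/-- The manifold structure pulled back along an open embedding. -/
noncomputable def comap (f : M → N) (hf : IsOpenEmbedding f) : BanachStructure 𝕜 M where
  Index := B.Index
  Model := B.Model
  chart i := (hf.toOpenPartialHomeomorph f).trans (B.chart i)
  exists_mem_source x := by
    obtain ⟨i, hi⟩ := B.exists_mem_source (f x)
    exact ⟨i, trivial, hi⟩
  analytic_trans := by
    rintro i j y ⟨⟨hyi, hyf⟩, -, hyj⟩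
    have hy : f ((hf.toOpenPartialHomeomorph f).symm ((B.chart i).symm y)) = (B.chart i).symm y :=
      (hf.toOpenPartialHomeomorph f).right_inv hyf
    refine (B.analytic_trans i j y ⟨hyi, mem_preimage.2 (hy ▸ hyj)⟩).congr ?_
    filter_upwards [((B.chart i).continuousAt_symm hyi).eventually
      ((hf.toOpenPartialHomeomorph f).eventually_right_inverse hyf)] with z hz
    exact congrArg (B.chart j) hz.symm
  hausdorff := by
    have := B.hausdorff
    exact hf.toIsEmbedding.t2Space

theorem isAnalytic_comap (hf : IsOpenEmbedding f) : IsAnalytic (comap B f hf) B f := by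
  intro x
  obtain ⟨i, hi⟩ := (comap B f hf).exists_mem_source x
  refine isAnalyticAt_of_chart hf.continuous.continuousAt hi hi.2 ?_
  exact analyticAt_id.congr
    (localRep_id_eventuallyEq (A := comap B f hf) hi).symm

theorem isAnalyticAt_comap (hf : IsOpenEmbedding f) {g : P → M} {z : P}
    (hg : IsAnalyticAt C B (f ∘ g) z) : IsAnalyticAt C (comap B f hf) g z :=
  ⟨hf.isInducing.continuousAt_iff.2 hg.1, fun k i hk hi => hg.2 k i hk hi.2⟩

end Comap

section Sigma

variable {I : Type u} {M : I → Type u} [∀ k, TopologicalSpace (M k)]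
  (A : ∀ k, BanachStructure 𝕜 (M k))

theorem isAnalyticAt_sigmaMk {k : I} (x : M k) :
    IsAnalyticAt (A k) (sigma A) (Sigma.mk k) x := by
  obtain ⟨i, hi⟩ := (A k).exists_mem_source x
  refine isAnalyticAt_of_chart (j := ⟨k, i⟩) continuous_sigmaMk.continuousAt hi ⟨x, hi, rfl⟩ ?_
  refine (analyticAt_localRep_id hi hi).congr (Eventually.of_forall fun y => ?_)
  exact (((A k).chart i).lift_openEmbedding_apply IsOpenEmbedding.sigmaMk).symm

variable {A}

theorem isAnalyticAt_sigma {f : (Σ k, M k) → N} {k : I} {x : M k}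
    (hf : IsAnalyticAt (A k) B (fun y => f ⟨k, y⟩) x) : IsAnalyticAt (sigma A) B f ⟨k, x⟩ := by
  obtain ⟨i, hi⟩ := (A k).exists_mem_source x
  obtain ⟨j, hj⟩ := B.exists_mem_source (f ⟨k, x⟩)
  refine isAnalyticAt_of_chart (i := ⟨k, i⟩) (IsOpenEmbedding.sigmaMk.continuousAt_iff.1 hf.1)
    ⟨x, hi, rfl⟩ hj ?_
  have hx : (sigma A).chart ⟨k, i⟩ ⟨k, x⟩ = (A k).chart i x :=
    ((A k).chart i).lift_openEmbedding_apply IsOpenEmbedding.sigmaMk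
  rw [hx]
  exact hf.2 i j hi hj

end Sigma

section Submersions

theorem leftInverse_fderiv_localRep {f : M → N} {g : N → M} {x : M} (hf : IsAnalyticAt A B f x)
    (hg : IsAnalyticAt B A g (f x)) (h : g ∘ f =ᶠ[𝓝 x] id) {i : A.Index} {j : B.Index}
    (hi : x ∈ (A.chart i).source) (hj : f x ∈ (B.chart j).source) :
    Function.LeftInverse (fderiv 𝕜 (localRep B A g j i) (B.chart j (f x)))
      (fderiv 𝕜 (localRep A B f i j) (A.chart i x)) := by
  have hgf : g (f x) = x := h.self_of_nhds
  have hid : localRep B A g j i ∘ localRep A B f i j =ᶠ[𝓝 (A.chart i x)] id :=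
    (localRep_comp_eventuallyEq g hf.1 i hi hj).symm.trans
      ((localRep_congr h i hi).trans (localRep_id_eventuallyEq hi))
  have hfx := (hf.2 i j hi hj).differentiableAt
  have hgx := (hg.2 j i hj (hgf.symm ▸ hi)).differentiableAt
  rw [← localRep_apply f j hi] at hgx ⊢
  exact fun v => DFunLike.congr_fun
    ((fderiv_comp _ hgx hfx).symm.trans (hid.fderiv_eq.trans fderiv_id)) v

theorem isImmersion_of_retraction {f : M → N} (hf : IsAnalytic A B f)
    (h : ∀ x, ∃ g : N → M, IsAnalyticAt B A g (f x) ∧ g ∘ f =ᶠ[𝓝 x] id) :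
    IsImmersion A B f := by
  refine ⟨hf, fun x i j hi hj => ?_⟩
  obtain ⟨g, hg, hgf⟩ := h x
  exact ⟨_, leftInverse_fderiv_localRep (hf x) hg hgf hi hj⟩

theorem isSubmersion_of_section {f : M → N} (hf : IsAnalytic A B f)
    (h : ∀ x, ∃ g : N → M, IsAnalyticAt B A g (f x) ∧ g (f x) = x ∧ f ∘ g =ᶠ[𝓝 (f x)] id) :
    IsSubmersion A B f := by
  refine ⟨hf, fun x i j hi hj => ?_⟩
  obtain ⟨g, hg, hgx, hfg⟩ := h x
  rw [← hgx] at hi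
  have hinv := leftInverse_fderiv_localRep hg (hgx.symm ▸ hf x) hfg hj hi
  rw [hgx] at hinv
  exact ⟨_, hinv⟩

theorem IsImmersion.exists_retraction {f : M → N} (hf : IsImmersion A B f) (x : M) :
    ∃ g : N → M, IsAnalyticAt B A g (f x) ∧ g ∘ f =ᶠ[𝓝 x] id := by
  obtain ⟨i, hi⟩ := A.exists_mem_source x
  obtain ⟨j, hj⟩ := B.exists_mem_source (f x)
  obtain ⟨g, hg, hgf⟩ := exists_analyticAt_leftInverse ((hf.1 x).2 i j hi hj) (hf.2 x i j hi hj)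
  have hgx := hgf.self_of_nhds
  rw [localRep_apply f j hi] at hg hgx
  refine ⟨(A.chart i).symm ∘ g ∘ B.chart j, ?_, ?_⟩
  · refine (isAnalyticAt_chart_symm ?_).comp
      ((isAnalyticAt_self_iff.2 hg).comp (isAnalyticAt_chart hj))
    rw [Function.comp_apply, hgx]
    exact (A.chart i).map_source hi
  · filter_upwards [((A.chart i).continuousAt hi).eventually hgf,
      (A.chart i).eventually_left_inverse hi] with y hgy hy
    rw [localRep, Function.comp_apply, Function.comp_apply, hy] at hgy
    simp only [Function.comp_apply, hgy, hy, id]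

theorem IsSubmersion.exists_section {f : M → N} (hf : IsSubmersion A B f) (x : M) :
    ∃ g : N → M, IsAnalyticAt B A g (f x) ∧ g (f x) = x ∧ f ∘ g =ᶠ[𝓝 (f x)] id := by
  obtain ⟨i, hi⟩ := A.exists_mem_source x
  obtain ⟨j, hj⟩ := B.exists_mem_source (f x)
  obtain ⟨g, hg, hgx, hfg⟩ :=
    exists_analyticAt_rightInverse ((hf.1 x).2 i j hi hj) (hf.2 x i j hi hj)
  rw [localRep_apply f j hi] at hg hgx hfg
  let s : N → M := (A.chart i).symm ∘ g ∘ B.chart j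
  have hs : IsAnalyticAt B A s (f x) := by
    refine (isAnalyticAt_chart_symm ?_).comp
      ((isAnalyticAt_self_iff.2 hg).comp (isAnalyticAt_chart hj))
    rw [Function.comp_apply, hgx]
    exact (A.chart i).map_source hi
  have hsx : s (f x) = x := by
    simp only [s, Function.comp_apply, hgx, (A.chart i).left_inv hi]
  have hfs : ContinuousAt (f ∘ s) (f x) := (hsx.symm ▸ (hf.1 x).1).comp hs.1
  refine ⟨s, hs, hsx, ?_⟩
  filter_upwards [((B.chart j).continuousAt hj).eventually hfg,
    (B.chart j).open_source.mem_nhds hj,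
    hfs.eventually ((B.chart j).open_source.mem_nhds (by rwa [Function.comp_apply, hsx]))]
    with y hy hyj hsy
  exact (B.chart j).injOn hsy hyj hy

theorem IsSubmersion.isAnalytic_of_comp {q : M → N} {f : N → P} (hq : IsSubmersion A B q)
    (hsurj : Function.Surjective q) (hf : IsAnalytic A C (f ∘ q)) : IsAnalytic B C f := by
  intro y
  obtain ⟨x, rfl⟩ := hsurj y
  obtain ⟨s, hs, hsx, hqs⟩ := hq.exists_section x
  exact (IsAnalyticAt.comp_of_eq (hf x) hs hsx).congr (hqs.mono fun z hz => congrArg f hz)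

theorem IsImmersion.isAnalyticAt_of_comp {f : M → N} {g : P → M} {z : P}
    (hf : IsImmersion A B f) (hg : ContinuousAt g z) (hfg : IsAnalyticAt C B (f ∘ g) z) :
    IsAnalyticAt C A g z := by
  obtain ⟨r, hr, hrf⟩ := hf.exists_retraction (g z)
  exact (hr.comp (f := f ∘ g) hfg).congr (hg.eventually hrf)

theorem IsImmersion.of_comp {f : M → N} {g : N → P} (hf : IsAnalytic A B f)
    (hg : IsAnalytic B C g) (hgf : IsImmersion A C (g ∘ f)) : IsImmersion A B f := by
  refine isImmersion_of_retraction hf fun x => ?_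
  obtain ⟨r, hr, hrx⟩ := hgf.exists_retraction x
  exact ⟨r ∘ g, IsAnalyticAt.comp (B := C) hr (hg (f x)), hrx⟩

theorem IsSubmersion.of_comp_surjective {q : M → N} {f : N → P} (hf : IsAnalytic B C f)
    (hq : IsAnalytic A B q) (hsurj : Function.Surjective q) (hfq : IsSubmersion A C (f ∘ q)) :
    IsSubmersion B C f := by
  refine isSubmersion_of_section hf fun y => ?_
  obtain ⟨x, rfl⟩ := hsurj y
  obtain ⟨s, hs, hsx, hfs⟩ := hfq.exists_section x
  exact ⟨q ∘ s, (hq x).comp_of_eq hs hsx, congrArg q hsx, hfs⟩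

theorem IsSubmersion.of_comp_injective {q : M → N} {f : N → P} (hq : IsAnalytic A B q)
    (hf : IsAnalytic B C f) (hinj : Function.Injective f) (hfq : IsSubmersion A C (f ∘ q)) :
    IsSubmersion A B q := by
  refine isSubmersion_of_section hq fun x => ?_
  obtain ⟨s, hs, hsx, hfs⟩ := hfq.exists_section x
  refine ⟨s ∘ f, IsAnalyticAt.comp (B := C) hs (hf (q x)), hsx, ?_⟩
  exact ((hf (q x)).1.eventually hfs).mono fun y hy => hinj hy

theorem IsSubmersion.isOpenMap {f : M → N} (hf : IsSubmersion A B f) : IsOpenMap f := by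
  refine IsOpenMap.of_nhds_le fun x => ?_
  obtain ⟨s, hs, hsx, hfs⟩ := hf.exists_section x
  have hsx' : Tendsto s (𝓝 (f x)) (𝓝 x) := by simpa only [ContinuousAt, hsx] using hs.1
  calc 𝓝 (f x) = map (f ∘ s) (𝓝 (f x)) := by rw [map_congr hfs, map_id]
    _ ≤ map f (𝓝 x) := map_map.symm.trans_le (map_mono hsx')

theorem IsSubmersion.isBianalyticOnto_range {f : M → N} (hf : IsSubmersion A B f) {g : N → M}
    (hgf : Function.LeftInverse g f) : IsBianalyticOnto A B f (range f) := by
  refine ⟨hf.isOpenMap.isOpen_range, rfl, hf.1, g, hgf, ?_⟩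
  rintro _ ⟨x, rfl⟩
  obtain ⟨s, hs, -, hfs⟩ := hf.exists_section x
  exact hs.congr (hfs.mono fun y hy => (hgf (s y)).symm.trans (congrArg g hy))

theorem exists_isSubmersion_of_isQuotientMap [Nonempty N] {q : M → N} {f : N → P}
    (hq : IsQuotientMap q) (hinj : Function.Injective f) (hfq : IsSubmersion A C (f ∘ q)) :
    ∃ B : BanachStructure 𝕜 N, IsSubmersion A B q := by
  have hf : IsOpenEmbedding f := by
    refine .of_continuous_injective_isOpenMap ?_ hinj ?_
    · exact hq.continuous_iff.2 (continuous_iff_continuousAt.2 fun x => (hfq.1 x).1)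
    · exact fun U hU => by
        rw [← hq.surjective.image_preimage U, ← image_comp]
        exact hfq.isOpenMap _ (hU.preimage hq.continuous)
  exact ⟨comap C f hf, .of_comp_injective (fun x => isAnalyticAt_comap hf (hfq.1 x))
    (isAnalytic_comap hf) hinj hfq⟩

theorem isSubmersion_sigma {I : Type u} {M : I → Type u} [∀ k, TopologicalSpace (M k)]
    {A : ∀ k, BanachStructure 𝕜 (M k)} {f : (Σ k, M k) → N}
    (hf : ∀ k, IsSubmersion (A k) B fun x => f ⟨k, x⟩) : IsSubmersion (sigma A) B f := by
  refine isSubmersion_of_section (fun x => isAnalyticAt_sigma ((hf x.1).1 x.2)) ?_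
  rintro ⟨k, x⟩
  obtain ⟨s, hs, hsx, hfs⟩ := (hf k).exists_section x
  exact ⟨Sigma.mk k ∘ s, (isAnalyticAt_sigmaMk A _).comp hs, congrArg (Sigma.mk k) hsx, hfs⟩

end Submersions

end BanachStructure

section Retracts

variable {𝕜 : Type w} [NontriviallyNormedField 𝕜] {V : Type*} [NormedAddCommGroup V]
  [NormedSpace 𝕜 V] {r : V → V} {S : Set V} {v : V}

variable (𝕜) in
/-- `r` restricts to an analytic retraction of a neighbourhood of `v` onto its intersection with
`S`. -/
structure IsAnalyticRetractionAt (r : V → V) (S : Set V) (v : V) : Prop where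
  analyticAt : AnalyticAt 𝕜 r v
  eventually_mem : ∀ᶠ z in 𝓝 v, r z ∈ S
  eventually_eq : ∀ᶠ z in 𝓝 v, z ∈ S → r z = z

namespace IsAnalyticRetractionAt

theorem apply_eq (hr : IsAnalyticRetractionAt 𝕜 r S v) (hv : v ∈ S) : r v = v :=
  hr.eventually_eq.self_of_nhds hv

theorem comp_self_eventuallyEq (hr : IsAnalyticRetractionAt 𝕜 r S v) (hv : v ∈ S) :
    r ∘ r =ᶠ[𝓝 v] r := by
  have hrv : Tendsto r (𝓝 v) (𝓝 v) := by
    simpa only [ContinuousAt, hr.apply_eq hv] using hr.analyticAt.continuousAt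
  filter_upwards [hrv.eventually hr.eventually_eq, hr.eventually_mem] with z hz hmem
  exact hz hmem

theorem fderiv_fderiv (hr : IsAnalyticRetractionAt 𝕜 r S v) (hv : v ∈ S) (z : V) :
    fderiv 𝕜 r v (fderiv 𝕜 r v z) = fderiv 𝕜 r v z := by
  have hd := hr.analyticAt.differentiableAt
  have hcomp := fderiv_comp v ((hr.apply_eq hv).symm ▸ hd) hd
  rw [(hr.comp_self_eventuallyEq hv).fderiv_eq, hr.apply_eq hv] at hcomp
  exact (DFunLike.congr_fun hcomp z).symm

theorem exists_straightening [CompleteSpace V] (hr : IsAnalyticRetractionAt 𝕜 r S v)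
    (hv : v ∈ S) :
    ∃ σ : V → V, AnalyticAt 𝕜 σ (fderiv 𝕜 r v v) ∧
      (∀ᶠ z in 𝓝 v, z ∈ S → σ (fderiv 𝕜 r v z) = z) ∧
      ∀ᶠ z in 𝓝 (fderiv 𝕜 r v v),
        σ z ∈ S ∧ (fderiv 𝕜 r v z = z → fderiv 𝕜 r v (σ z) = z) := by
  set p := fderiv 𝕜 r v
  have hpp : ∀ z, p (p z) = p z := hr.fderiv_fderiv hv
  let q : V →L[𝕜] V := 1 - p
  let Φ : V → V := fun z => p (r z) + q (z - r z)
  have hΦS : ∀ z, r z = z → Φ z = p z := fun z hz => by simp [Φ, hz]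
  have hpΦ : ∀ z, p (Φ z) = p (r z) := fun z => by simp [Φ, q, hpp]
  have hΦ : AnalyticAt 𝕜 Φ v :=
    ((p.analyticAt _).comp hr.analyticAt).add
      ((q.analyticAt _).fun_comp (analyticAt_id.sub hr.analyticAt))
  have hΦ' : HasFDerivAt Φ (ContinuousLinearEquiv.refl 𝕜 V : V →L[𝕜] V) v := by
    have hr' := hr.analyticAt.differentiableAt.hasFDerivAt
    refine ((p.hasFDerivAt.comp v hr').add
      (q.hasFDerivAt.comp v ((hasFDerivAt_id v).sub hr'))).congr_fderiv ?_
    ext z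
    simp [q, p, hpp]
  obtain ⟨Ψ, hΨ, hΨΦ, hΦΨ⟩ := exists_analyticAt_inverse hΦ hΦ'
  have hΦv : Φ v = p v := hΦS v (hr.apply_eq hv)
  have hΨv : Ψ (p v) = v := hΦv ▸ hΨΦ.self_of_nhds
  rw [hΦv] at hΨ hΦΨ
  have hΨtendsto : Tendsto Ψ (𝓝 (p v)) (𝓝 v) := by
    simpa only [ContinuousAt, hΨv] using hΨ.continuousAt
  refine ⟨r ∘ Ψ, hr.analyticAt.comp_of_eq hΨ hΨv, ?_, ?_⟩
  · filter_upwards [hΨΦ, hr.eventually_eq] with z hz hzS hmem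
    rw [← hΦS z (hzS hmem), Function.comp_apply, hz, hzS hmem]
  · filter_upwards [hΦΨ, hΨtendsto.eventually hr.eventually_mem] with z hz hmem
    exact ⟨hmem, fun hpz => by rw [Function.comp_apply, ← hpΦ, hz, hpz]⟩

end IsAnalyticRetractionAt

theorem exists_openPartialHomeomorph_of_local_inverse {Y Z : Type*} [TopologicalSpace Y]
    [TopologicalSpace Z] {f : Y → Z} {g : Z → Y} {y : Y} {t : Set Z} (hf : Continuous f)
    (ht : IsOpen t) (hyt : f y ∈ t) (hg : ContinuousOn g t) (hfg : ∀ z ∈ t, f (g z) = z)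
    (hgf : ∀ᶠ y' in 𝓝 y, g (f y') = y') :
    ∃ c : OpenPartialHomeomorph Y Z, y ∈ c.source ∧ c.target ⊆ t ∧ ⇑c = f ∧ ⇑c.symm = g := by
  obtain ⟨s, hs, hso, hys⟩ :=
    eventually_nhds_iff.1 (hgf.and (hf.continuousAt.eventually (ht.mem_nhds hyt)))
  exact ⟨{
    toFun := f
    invFun := g
    source := s
    target := t ∩ g ⁻¹' s
    map_source' := fun z hz => ⟨(hs z hz).2, mem_preimage.2 ((hs z hz).1.symm ▸ hz)⟩
    map_target' := fun z hz => hz.2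
    left_inv' := fun z hz => (hs z hz).1
    right_inv' := fun z hz => hfg z hz.1
    open_source := hso
    open_target := hg.isOpen_inter_preimage ht hso
    continuousOn_toFun := hf.continuousOn
    continuousOn_invFun := hg.mono inter_subset_left }, hys, inter_subset_left, rfl, rfl⟩

end Retracts

section ProjectionCharts

variable {𝕜 : Type w} [NontriviallyNormedField 𝕜] {M V : Type u} [TopologicalSpace M]
  [NormedAddCommGroup V] [NormedSpace 𝕜 V] [CompleteSpace V] {e : M → V}

variable (𝕜) in
/-- A chart of `M` that is the restriction, along `e : M → V`, of a linear map on `V`, and whose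
inverse, viewed in `V`, is analytic. Any two such charts are analytically compatible. -/
structure ProjectionChart (e : M → V) where
  Model : Type u
  [normed : NormedAddCommGroup Model]
  [space : NormedSpace 𝕜 Model]
  [complete : CompleteSpace Model]
  proj : V →L[𝕜] Model
  chart : OpenPartialHomeomorph M Model
  chart_apply : ∀ y, chart y = proj (e y)
  analyticOnNhd_symm : AnalyticOnNhd 𝕜 (e ∘ chart.symm) chart.target

attribute [instance] ProjectionChart.normed ProjectionChart.space ProjectionChart.complete

theorem exists_projectionChart (he : IsEmbedding e) {x : M} {r : V → V}
    (hr : IsAnalyticRetractionAt 𝕜 r (range e) (e x)) :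
    ∃ c : ProjectionChart 𝕜 e, x ∈ c.chart.source := by
  have hx := mem_range_self (f := e) x
  obtain ⟨σ, hσ, hσp, hpσ⟩ := hr.exists_straightening hx
  set p := fderiv 𝕜 r (e x)
  let K : Submodule 𝕜 V := LinearMap.eqLocus p.toLinearMap LinearMap.id
  let P : V →L[𝕜] K := p.codRestrict K (hr.fderiv_fderiv hx)
  have : CompleteSpace K := (isClosed_eq p.continuous continuous_id).completeSpace_coe
  have : Nonempty M := ⟨x⟩
  have hcoe : Tendsto ((↑) : K → V) (𝓝 (P (e x))) (𝓝 (p (e x))) :=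
    continuous_subtype_val.continuousAt
  obtain ⟨t, ht, hto, hxt⟩ := eventually_nhds_iff.1
    (hcoe.eventually (hσ.eventually_analyticAt.and hpσ))
  let g : K → M := fun z => Function.invFun e (σ z)
  have heg : ∀ z ∈ t, e (g z) = σ z := fun z hz => Function.invFun_eq (ht z hz).2.1
  have hσt : ∀ z ∈ t, AnalyticAt 𝕜 (fun z : K => σ z) z := fun z hz =>
    (ht z hz).1.fun_comp_of_eq (K.subtypeL.analyticAt z) rfl
  have hegt : EqOn (e ∘ g) (fun z : K => σ z) t := heg
  obtain ⟨c, hxc, hct, hc, hcsymm⟩ := exists_openPartialHomeomorph_of_local_inverse (f := P ∘ e)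
    (g := g) (P.continuous.comp he.continuous) hto hxt
    (he.continuousOn_iff.2 (ContinuousOn.congr
      (fun z hz => (hσt z hz).continuousAt.continuousWithinAt) hegt))
    (fun z hz => Subtype.ext ((congrArg p (heg z hz)).trans ((ht z hz).2.2 z.2)))
    ((he.continuous.continuousAt.eventually hσp).mono fun y hy =>
      (congrArg (Function.invFun e) (hy (mem_range_self y))).trans
        (Function.leftInverse_invFun he.injective y))
  refine ⟨⟨K, P, c, fun y => congrFun hc y, fun z hz => ?_⟩, hxc⟩
  rw [hcsymm]
  exact (hσt z (hct hz)).congr ((hegt.eventuallyEq_of_mem (hto.mem_nhds (hct hz))).symm)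

/-- The manifold structure on a subspace covered by projection charts. -/
noncomputable def ofProjectionCharts (he : IsEmbedding e) (c : M → ProjectionChart 𝕜 e)
    (hc : ∀ x, x ∈ (c x).chart.source) : BanachStructure 𝕜 M where
  Index := M
  Model x := (c x).Model
  chart x := (c x).chart
  exists_mem_source x := ⟨x, hc x⟩
  analytic_trans x y z hz := by
    refine (((c y).proj.analyticAt _).comp ((c x).analyticOnNhd_symm z hz.1)).congr ?_
    exact Eventually.of_forall fun z' => ((c y).chart_apply _).symm
  hausdorff := he.t2Space

open BanachStructure in
theorem exists_isImmersion_self (he : IsEmbedding e)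
    (h : ∀ x, ∃ r, IsAnalyticRetractionAt 𝕜 r (range e) (e x)) :
    ∃ A : BanachStructure 𝕜 M, A.IsImmersion (.self V) e := by
  choose c hc using fun x => exists_projectionChart he (h x).choose_spec
  have hmap x := (c x).chart.map_source (hc x)
  refine ⟨ofProjectionCharts he c hc, isImmersion_of_retraction (fun x => ?_) (fun x => ?_)⟩
  · exact (isAnalyticAt_self_iff_comp_symm (A := ofProjectionCharts he c hc) (i := x) (hc x)).2
      ((c x).analyticOnNhd_symm _ (hmap x))
  · refine ⟨(c x).chart.symm ∘ (c x).proj, ?_, ?_⟩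
    · refine IsAnalyticAt.comp (B := .self (c x).Model) ?_
        (isAnalyticAt_self_iff.2 ((c x).proj.analyticAt _))
      refine isAnalyticAt_chart_symm (A := ofProjectionCharts he c hc) (i := x) ?_
      exact (c x).chart_apply x ▸ hmap x
    · filter_upwards [(c x).chart.eventually_left_inverse (hc x)] with y hy
      rw [Function.comp_apply, Function.comp_apply, ← (c x).chart_apply, hy, id]

end ProjectionCharts

section GeneralLinearGroup

open BanachStructure

variable {𝕜 : Type w} [NontriviallyNormedField 𝕜] {X : Type u} [NormedAddCommGroup X]
  [NormedSpace 𝕜 X] [CompleteSpace X] {M : Type u} [TopologicalSpace M]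
  {A : BanachStructure 𝕜 M} {f g : M → BanachGL 𝕜 X} {x : M}

theorem isAnalytic_units_val :
    (glStructure 𝕜 X).IsAnalytic (self (X →L[𝕜] X)) Units.val := fun _ =>
  isAnalyticAt_chart (A := glStructure 𝕜 X) (i := ⟨⟩) trivial

theorem isAnalyticAt_gl_iff :
    IsAnalyticAt A (glStructure 𝕜 X) f x ↔
      IsAnalyticAt A (self (X →L[𝕜] X)) (fun y => (f y).val) x :=
  ⟨fun h => (isAnalytic_units_val _).comp h, fun h =>
    ⟨Units.isOpenEmbedding_val.isInducing.continuousAt_iff.2 h.1, fun i _ hi _ =>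
      h.2 i ⟨⟩ hi trivial⟩⟩

theorem isAnalyticAt_gl_const (W : BanachGL 𝕜 X) :
    IsAnalyticAt A (glStructure 𝕜 X) (fun _ => W) x :=
  isAnalyticAt_gl_iff.2 ⟨continuousAt_const, fun _ _ _ _ => analyticAt_const (v := W.val)⟩

theorem isAnalyticAt_gl_mul (hf : IsAnalyticAt A (glStructure 𝕜 X) f x)
    (hg : IsAnalyticAt A (glStructure 𝕜 X) g x) :
    IsAnalyticAt A (glStructure 𝕜 X) (fun y => f y * g y) x :=
  isAnalyticAt_gl_iff.2 ((isAnalyticAt_gl_iff.1 hf).mul (isAnalyticAt_gl_iff.1 hg))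

theorem isAnalyticAt_gl_inv (hf : IsAnalyticAt A (glStructure 𝕜 X) f x) :
    IsAnalyticAt A (glStructure 𝕜 X) (fun y => (f y)⁻¹) x := by
  have hinv := isAnalyticAt_self_iff.2 (analyticAt_inverse (𝕜 := 𝕜) (f x))
  have hcomp := hinv.comp (f := fun y => (f y).val) (isAnalyticAt_gl_iff.1 hf)
  exact isAnalyticAt_gl_iff.2 (hcomp.congr (.of_forall fun y => Ring.inverse_unit (f y)))

/-- The inverse of the chart of `GL X`: it sends an invertible operator to the corresponding unit,
and has junk values elsewhere. -/
noncomputable def unitOfOperator : (X →L[𝕜] X) → BanachGL 𝕜 X :=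
  (Units.isOpenEmbedding_val.toOpenPartialHomeomorph Units.val).symm

theorem unitOfOperator_val (W : BanachGL 𝕜 X) : unitOfOperator W.val = W :=
  Units.isOpenEmbedding_val.toOpenPartialHomeomorph_left_inv _

theorem isAnalyticAt_unitOfOperator (W : BanachGL 𝕜 X) :
    IsAnalyticAt (self (X →L[𝕜] X)) (glStructure 𝕜 X) unitOfOperator W.val :=
  isAnalyticAt_chart_symm (A := glStructure 𝕜 X) (i := ⟨⟩)
    ((Units.isOpenEmbedding_val.toOpenPartialHomeomorph Units.val).map_source trivial)

end GeneralLinearGroup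

section Actions

theorem isClopen_orbit_of_isOpen {G Y : Type*} [Group G] [MulAction G Y] [TopologicalSpace Y]
    (h : ∀ y : Y, IsOpen (MulAction.orbit G y)) (y : Y) : IsClopen (MulAction.orbit G y) := by
  refine ⟨⟨isOpen_iff_mem_nhds.2 fun z hz => ?_⟩, h y⟩
  filter_upwards [(h z).mem_nhds (MulAction.mem_orbit_self z)] with z' hz' hy
  rw [← MulAction.orbit_eq_iff] at hy hz'
  exact hz (MulAction.orbit_eq_iff.1 (hz'.symm.trans hy))

theorem exists_isOrbitTransversal (G : Type u) {Y : Type u} [Group G] [MulAction G Y] :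
    ∃ R : Set Y, IsOrbitTransversal G R := by
  refine ⟨range (Quotient.out : MulAction.orbitRel.Quotient G Y → Y), fun y => ?_⟩
  refine ⟨Quotient.out (Quotient.mk (MulAction.orbitRel G Y) y), ⟨⟨_, rfl⟩, ?_⟩, ?_⟩
  · exact (MulAction.orbitRel G Y).symm (Quotient.mk_out (s := MulAction.orbitRel G Y) y)
  · rintro _ ⟨⟨c, rfl⟩, hc⟩
    rw [← Quotient.out_eq c, Quotient.sound (s := MulAction.orbitRel G Y) hc]

theorem range_ofQuotientStabilizer (G : Type*) {Y : Type*} [Group G] [MulAction G Y] (y : Y) :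
    range (MulAction.ofQuotientStabilizer G y) = MulAction.orbit G y :=
  (QuotientGroup.mk_surjective.range_comp (MulAction.ofQuotientStabilizer G y)).symm

theorem injective_sigma_ofQuotientStabilizer {G Y : Type u} [Group G] [MulAction G Y] {R : Set Y}
    (hR : IsOrbitTransversal G R) :
    Function.Injective fun p : Σ y : R, G ⧸ MulAction.stabilizer G y.1 =>
      MulAction.ofQuotientStabilizer G p.1.1 p.2 := by
  rintro ⟨y, a⟩ ⟨z, b⟩ (hab : MulAction.ofQuotientStabilizer G y.1 a = _)
  have mem_orbit (w : R) (c : G ⧸ MulAction.stabilizer G w.1) :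
      MulAction.ofQuotientStabilizer G w.1 c ∈ MulAction.orbit G w.1 :=
    range_ofQuotientStabilizer G w.1 ▸ mem_range_self c
  obtain rfl : y = z := Subtype.ext
    ((hR _).unique ⟨y.2, mem_orbit y a⟩ ⟨z.2, hab ▸ mem_orbit z b⟩)
  exact congrArg (Sigma.mk y) (MulAction.injective_ofQuotientStabilizer G y.1 hab)

theorem range_sigma_ofQuotientStabilizer {G Y : Type u} [Group G] [MulAction G Y] {R : Set Y}
    (hR : IsOrbitTransversal G R) :
    (range fun p : Σ y : R, G ⧸ MulAction.stabilizer G y.1 =>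
      MulAction.ofQuotientStabilizer G p.1.1 p.2) = univ := by
  refine eq_univ_of_forall fun z => ?_
  obtain ⟨y, ⟨hy, W, hW⟩, -⟩ := hR z
  exact ⟨⟨⟨y, hy⟩, QuotientGroup.mk W⟩, hW⟩

end Actions

section OrbitMaps

open BanachStructure MulAction

variable {𝕜 : Type w} [NontriviallyNormedField 𝕜] {X : Type u} [NormedAddCommGroup X]
  [NormedSpace 𝕜 X] [CompleteSpace X] {Y : Type u} [TopologicalSpace Y]
  [MulAction (BanachGL 𝕜 X) Y] {B : BanachStructure 𝕜 Y} {y : Y}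

theorem isSubmersion_orbitMap
    (hact : ∀ y, IsAnalyticAt (glStructure 𝕜 X) B (fun W : BanachGL 𝕜 X => W • y) 1)
    (hsec : ∀ y, ∃ s : Y → BanachGL 𝕜 X,
      IsAnalyticAt B (glStructure 𝕜 X) s y ∧ s y = 1 ∧ ∀ᶠ z in 𝓝 y, s z • y = z) (y : Y) :
    IsSubmersion (glStructure 𝕜 X) B fun W : BanachGL 𝕜 X => W • y := by
  have hid (W : BanachGL 𝕜 X) : IsAnalyticAt (glStructure 𝕜 X) (glStructure 𝕜 X) id W :=
    isAnalyticAt_gl_iff.2 (isAnalytic_units_val W)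
  refine isSubmersion_of_section (fun W => ?_) (fun W => ?_)
  · have htrans := isAnalyticAt_gl_mul (hid W) (isAnalyticAt_gl_const W⁻¹)
    refine ((hact (W • y)).comp_of_eq htrans (mul_inv_cancel W)).congr ?_
    exact Eventually.of_forall fun V => by simp [smul_smul]
  · obtain ⟨s, hs, hsW, hsy⟩ := hsec (W • y)
    refine ⟨fun z => s z * W, isAnalyticAt_gl_mul hs (isAnalyticAt_gl_const W), ?_, ?_⟩
    · simp only [hsW, one_mul]
    · exact hsy.mono fun z hz => (mul_smul _ _ _).trans hz

theorem isClopen_orbit_of_isSubmersion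
    (h : ∀ y, IsSubmersion (glStructure 𝕜 X) B fun W : BanachGL 𝕜 X => W • y) (y : Y) :
    IsClopen (orbit (BanachGL 𝕜 X) y) :=
  isClopen_orbit_of_isOpen (fun z => (h z).isOpenMap.isOpen_range) y

section Stabilizer

variable (h : IsSubmersion (glStructure 𝕜 X) B fun W : BanachGL 𝕜 X => W • y)
include h

theorem exists_isAnalyticRetractionAt_stabilizer (U : stabilizer (BanachGL 𝕜 X) y) :
    ∃ r, IsAnalyticRetractionAt 𝕜 r
      (range fun W : stabilizer (BanachGL 𝕜 X) y => W.1.val) U.1.val := by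
  obtain ⟨s, hs, hs1, hsy⟩ := h.exists_section 1
  rw [one_smul] at hs hs1 hsy
  have hU : U.1 • y = y := U.2
  let R : BanachGL 𝕜 X → BanachGL 𝕜 X := fun W => (s (W • y))⁻¹ * W
  have hid : IsAnalyticAt (glStructure 𝕜 X) (glStructure 𝕜 X) id U.1 :=
    isAnalyticAt_gl_iff.2 (isAnalytic_units_val U.1)
  have hR : IsAnalyticAt (glStructure 𝕜 X) (glStructure 𝕜 X) R U.1 :=
    isAnalyticAt_gl_mul (isAnalyticAt_gl_inv (hs.comp_of_eq (h.1 U.1) hU)) hid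
  have hmem : ∀ᶠ W in 𝓝 U.1, R W ∈ stabilizer (BanachGL 𝕜 X) y := by
    have horbit : Tendsto (fun W : BanachGL 𝕜 X => W • y) (𝓝 U.1) (𝓝 y) := by
      simpa only [ContinuousAt, hU] using (h.1 U.1).1
    filter_upwards [horbit.eventually hsy] with W hW
    rw [mem_stabilizer_iff, mul_smul, inv_smul_eq_iff]
    exact hW.symm
  refine ⟨Units.val ∘ R ∘ unitOfOperator, isAnalyticAt_self_iff.1 ?_, ?_, ?_⟩
  · exact (isAnalytic_units_val _).comp (hR.comp_of_eq (isAnalyticAt_unitOfOperator U.1)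
      (unitOfOperator_val U.1))
  · rw [← Units.isOpenEmbedding_val.map_nhds_eq, eventually_map]
    filter_upwards [hmem] with W hW
    exact ⟨⟨R W, hW⟩, congrArg (Units.val ∘ R) (unitOfOperator_val W).symm⟩
  · refine Eventually.of_forall ?_
    rintro _ ⟨W, rfl⟩
    have hW : W.1 • y = y := W.2
    simp only [Function.comp_apply, unitOfOperator_val, R, hW, hs1, inv_one, one_mul]

theorem isBanachLieSubgroup_stabilizer :
    IsBanachLieSubgroup (stabilizer (BanachGL 𝕜 X) y) := by
  obtain ⟨A, hA⟩ := exists_isImmersion_self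
    (Units.isOpenEmbedding_val.isEmbedding.comp .subtypeVal)
    (exists_isAnalyticRetractionAt_stabilizer h)
  have hval : IsImmersion A (glStructure 𝕜 X) Subtype.val :=
    .of_comp (fun W => isAnalyticAt_gl_iff.2 (hA.1 W)) isAnalytic_units_val hA
  refine ⟨A, hval, fun p => ?_, fun W => ?_⟩
  · exact hval.isAnalyticAt_of_comp continuous_mul.continuousAt
      (isAnalyticAt_gl_mul ((hval.1 _).comp (isAnalyticAt_fst p))
        ((hval.1 _).comp (isAnalyticAt_snd p)))
  · exact hval.isAnalyticAt_of_comp continuous_inv.continuousAt (isAnalyticAt_gl_inv (hval.1 W))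

theorem exists_isHomogeneousStructure_stabilizer :
    ∃ A, IsHomogeneousStructure (stabilizer (BanachGL 𝕜 X) y) A :=
  exists_isSubmersion_of_isQuotientMap isQuotientMap_quotient_mk'
    (injective_ofQuotientStabilizer (BanachGL 𝕜 X) y) h

theorem isSubmersion_ofQuotientStabilizer
    {A : BanachStructure 𝕜 (BanachGL 𝕜 X ⧸ stabilizer (BanachGL 𝕜 X) y)}
    (hA : IsHomogeneousStructure _ A) :
    IsSubmersion A B (ofQuotientStabilizer (BanachGL 𝕜 X) y) :=
  .of_comp_surjective (hA.isAnalytic_of_comp QuotientGroup.mk_surjective h.1) hA.1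
    QuotientGroup.mk_surjective h

theorem isBianalyticOnto_ofQuotientStabilizer
    {A : BanachStructure 𝕜 (BanachGL 𝕜 X ⧸ stabilizer (BanachGL 𝕜 X) y)}
    (hA : IsHomogeneousStructure _ A) :
    IsBianalyticOnto A B (ofQuotientStabilizer (BanachGL 𝕜 X) y) (orbit (BanachGL 𝕜 X) y) :=
  range_ofQuotientStabilizer (BanachGL 𝕜 X) y ▸
    (isSubmersion_ofQuotientStabilizer h hA).isBianalyticOnto_range
      (Function.leftInverse_invFun (injective_ofQuotientStabilizer (BanachGL 𝕜 X) y))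

end Stabilizer

theorem isBianalyticOnto_sigma_ofQuotientStabilizer
    (h : ∀ y, IsSubmersion (glStructure 𝕜 X) B fun W : BanachGL 𝕜 X => W • y) {R : Set Y}
    (hR : IsOrbitTransversal (BanachGL 𝕜 X) R)
    {A : ∀ y : R, BanachStructure 𝕜 (BanachGL 𝕜 X ⧸ stabilizer (BanachGL 𝕜 X) y.1)}
    (hA : ∀ y, IsHomogeneousStructure _ (A y)) :
    IsBianalyticOnto (sigma A) B
      (fun p => ofQuotientStabilizer (BanachGL 𝕜 X) p.1.1 p.2) univ := by
  have hsub : IsSubmersion (sigma A) B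
      fun p => ofQuotientStabilizer (BanachGL 𝕜 X) p.1.1 p.2 :=
    isSubmersion_sigma fun y => isSubmersion_ofQuotientStabilizer (h y) (hA y)
  have hrange := range_sigma_ofQuotientStabilizer hR
  exact hrange ▸ hsub.isBianalyticOnto_range (Function.leftInverse_surjInv
    ⟨injective_sigma_ofQuotientStabilizer hR, range_eq_univ.1 hrange⟩)

end OrbitMaps

section Intertwiner

variable {R : Type*} [Ring R] {P Q : R}

/-- The canonical element that intertwines two idempotents `Q` and `P`; where it is invertible, it
conjugates `Q` to `P`. -/
def intertwiner (Q P : R) : R := P * Q + (1 - P) * (1 - Q)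

theorem mul_intertwiner (hP : P * P = P) (hQ : Q * Q = Q) :
    P * intertwiner Q P = intertwiner Q P * Q := by
  have hleft : P * intertwiner Q P = P * Q := by
    simp only [intertwiner, mul_add, ← mul_assoc, mul_sub, mul_one, hP, sub_self, zero_mul,
      add_zero]
  have hright : intertwiner Q P * Q = P * Q := by
    simp only [intertwiner, add_mul, mul_assoc, sub_mul, one_mul, hQ, sub_self, mul_zero,
      add_zero]
  rw [hleft, hright]

theorem intertwiner_self (hQ : Q * Q = Q) : intertwiner Q Q = 1 := by
  simp only [intertwiner, mul_sub, sub_mul, mul_one, one_mul, hQ, sub_self, sub_zero,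
    add_sub_cancel]

end Intertwiner

section Idempotents

open BanachStructure

variable {𝕜 : Type w} [NontriviallyNormedField 𝕜] {X : Type u} [NormedAddCommGroup X]
  [NormedSpace 𝕜 X]

theorem smul_eq_of_mul_eq {W : BanachGL 𝕜 X} {P Q : Idem 𝕜 X} (h : P.1 * W.val = W.val * Q.1) :
    W • Q = P :=
  Subtype.ext (W.mul_inv_eq_iff_eq_mul.2 h.symm)

theorem kappa_smul (W : BanachGL 𝕜 X) (Q : Idem 𝕜 X) : kappa (W • Q) = W • kappa Q := by
  refine Subtype.ext (SetLike.ext fun x => ⟨?_, ?_⟩)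
  · rintro ⟨y, rfl⟩
    exact ⟨_, ⟨(W⁻¹).val y, rfl⟩, rfl⟩
  · rintro ⟨_, ⟨y, rfl⟩, rfl⟩
    exact ⟨W.val y, congrArg (fun z => W.val (Q.1 z)) (DFunLike.congr_fun W.inv_mul y)⟩

theorem isEmbedding_idem_val : IsEmbedding fun Q : Idem 𝕜 X => Q.1 :=
  IsEmbedding.subtypeVal

variable [CompleteSpace X]

theorem isAnalyticAt_unitOfOperator_intertwiner (Q : Idem 𝕜 X) :
    IsAnalyticAt (self (X →L[𝕜] X)) (glStructure 𝕜 X)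
      (fun B => unitOfOperator (intertwiner Q.1 B)) Q.1 := by
  have h : AnalyticAt 𝕜 (intertwiner Q.1) Q.1 :=
    (analyticAt_id.mul analyticAt_const).add
      ((analyticAt_const.sub analyticAt_id).mul analyticAt_const)
  exact (isAnalyticAt_unitOfOperator 1).comp_of_eq (isAnalyticAt_self_iff.2 h)
    (intertwiner_self Q.2.1)

theorem unitOfOperator_intertwiner_self (Q : Idem 𝕜 X) :
    unitOfOperator (intertwiner Q.1 Q.1) = 1 :=
  (congrArg unitOfOperator (intertwiner_self Q.2.1)).trans (unitOfOperator_val 1)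

theorem eventually_unitOfOperator_intertwiner_smul (Q : Idem 𝕜 X) :
    ∀ᶠ B in 𝓝 Q.1, ∀ P : Idem 𝕜 X, P.1 = B → unitOfOperator (intertwiner Q.1 B) • Q = P := by
  have hcont : ContinuousAt (intertwiner Q.1) Q.1 := by
    unfold intertwiner
    fun_prop
  have hunit : {T : X →L[𝕜] X | IsUnit T} ∈ 𝓝 (intertwiner Q.1 Q.1) :=
    Units.isOpen.mem_nhds (by
      rw [intertwiner_self Q.2.1]
      exact isUnit_one)
  filter_upwards [hcont.eventually hunit]
  rintro _ ⟨U, hU⟩ P rfl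
  rw [← hU, unitOfOperator_val]
  exact smul_eq_of_mul_eq (hU.symm ▸ mul_intertwiner P.2.1 Q.2.1)

theorem isAnalytic_val_smul (Q : Idem 𝕜 X) :
    IsAnalytic (glStructure 𝕜 X) (self (X →L[𝕜] X)) fun W : BanachGL 𝕜 X => (W • Q).1 := by
  intro W
  have hval := isAnalytic_units_val W
  have hid : IsAnalyticAt (glStructure 𝕜 X) (glStructure 𝕜 X) id W :=
    isAnalyticAt_gl_iff.2 hval
  have hconst : IsAnalyticAt (glStructure 𝕜 X) (self (X →L[𝕜] X)) (fun _ => Q.1) W :=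
    ⟨continuousAt_const, fun _ _ _ _ => analyticAt_const (v := Q.1)⟩
  exact (hval.mul hconst).mul (isAnalyticAt_gl_iff.1 (isAnalyticAt_gl_inv hid))

theorem isAnalyticRetractionAt_idem (Q : Idem 𝕜 X) :
    IsAnalyticRetractionAt 𝕜 (fun B => (unitOfOperator (intertwiner Q.1 B) • Q).1)
      (range fun P : Idem 𝕜 X => P.1) Q.1 where
  analyticAt := isAnalyticAt_self_iff.1
    ((isAnalytic_val_smul Q _).comp (isAnalyticAt_unitOfOperator_intertwiner Q))
  eventually_mem := .of_forall fun _ => mem_range_self _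
  eventually_eq := (eventually_unitOfOperator_intertwiner_smul Q).mono fun _ hB ⟨P, hP⟩ =>
    (congrArg Subtype.val (hB P hP)).trans hP

theorem exists_isSubmanifoldStructure :
    ∃ I : BanachStructure 𝕜 (Idem 𝕜 X), IsSubmanifoldStructure I :=
  exists_isImmersion_self isEmbedding_idem_val fun Q => ⟨_, isAnalyticRetractionAt_idem Q⟩

theorem isSubmersion_orbitMap_idem {I : BanachStructure 𝕜 (Idem 𝕜 X)}
    (hI : IsSubmanifoldStructure I) (Q : Idem 𝕜 X) :
    IsSubmersion (glStructure 𝕜 X) I fun W : BanachGL 𝕜 X => W • Q := by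
  refine isSubmersion_orbitMap (fun Q => ?_) (fun Q => ?_) Q
  · have hval := isAnalytic_val_smul Q 1
    exact hI.isAnalyticAt_of_comp (isEmbedding_idem_val.isInducing.continuousAt_iff.2 hval.1) hval
  · have hval : ContinuousAt (fun P : Idem 𝕜 X => P.1) Q :=
      isEmbedding_idem_val.continuous.continuousAt
    refine ⟨fun P => unitOfOperator (intertwiner Q.1 P.1),
      (isAnalyticAt_unitOfOperator_intertwiner Q).comp (hI.1 Q),
      unitOfOperator_intertwiner_self Q, ?_⟩
    exact (hval.eventually (eventually_unitOfOperator_intertwiner_smul Q)).mono fun P hP => hP P rfl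

end Idempotents

section Grassmannian

open BanachStructure

variable {𝕜 : Type w} [NontriviallyNormedField 𝕜] {X : Type u} [NormedAddCommGroup X]
  [NormedSpace 𝕜 X] [CompleteSpace X]

/-- The block `E → E` of an operator, with respect to the decomposition `X = E ⊕ F` given by
`i = (E, F)`. -/
noncomputable def diagonalBlock (i : ComplPair 𝕜 X) (T : X →L[𝕜] X) :
    i.1.1.1 →L[𝕜] i.1.1.1 :=
  (i.1.1.1).projectionOntoL i.1.2.1 (Grassmannian.isTopCompl i.2) ∘L T ∘L i.1.1.1.subtypeL

/-- The block `E → F` of an operator, with respect to the decomposition `X = E ⊕ F` given by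
`i = (E, F)`. -/
noncomputable def offDiagonalBlock (i : ComplPair 𝕜 X) (T : X →L[𝕜] X) :
    i.1.1.1 →L[𝕜] i.1.2.1 :=
  (i.1.2.1).projectionOntoL i.1.1.1 (Grassmannian.isTopCompl i.2).symm ∘L T ∘L i.1.1.1.subtypeL

theorem diagonalBlock_one (i : ComplPair 𝕜 X) :
    diagonalBlock i 1 = ContinuousLinearMap.id 𝕜 i.1.1.1 :=
  ContinuousLinearMap.ext fun e =>
    Submodule.projectionOntoL_apply_left (Grassmannian.isTopCompl i.2) e

theorem diagonalBlock_add_offDiagonalBlock (i : ComplPair 𝕜 X) (T : X →L[𝕜] X) (e : i.1.1.1) :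
    (diagonalBlock i T e : X) + offDiagonalBlock i T e = T e :=
  Submodule.projectionL_add_projectionL_eq_self (Grassmannian.isTopCompl i.2) (T e)

theorem smul_eq_param {i : ComplPair 𝕜 X} {W : BanachGL 𝕜 X}
    (h : (diagonalBlock i W.val).IsInvertible) :
    W • i.1.1 = param i (offDiagonalBlock i W.val ∘L (diagonalBlock i W.val).inverse) := by
  obtain ⟨A, hA⟩ := h
  rw [← hA, ContinuousLinearMap.inverse_equiv]
  have hsum (e : i.1.1.1) : (A e : X) + offDiagonalBlock i W.val (A.symm (A e)) = W.val e := by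
    rw [A.symm_apply_apply, ← diagonalBlock_add_offDiagonalBlock i W.val e, ← hA]
    rfl
  refine Subtype.ext (SetLike.ext fun x => ⟨?_, ?_⟩)
  · rintro ⟨e, he, rfl⟩
    exact ⟨A ⟨e, he⟩, hsum ⟨e, he⟩⟩
  · rintro ⟨e, rfl⟩
    have hsum' := hsum (A.symm e)
    rw [A.apply_symm_apply] at hsum'
    exact ⟨A.symm e, (A.symm e).2, hsum'.symm⟩

theorem isAnalyticAt_one_smul_grassmannian (E : Grassmannian 𝕜 X) :
    IsAnalyticAt (glStructure 𝕜 X) (grassmannStructure 𝕜 X) (fun W : BanachGL 𝕜 X => W • E) 1 := by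
  obtain ⟨i, rfl⟩ := exists_complPair E
  have hdiag : ContDiff 𝕜 ⊤ (diagonalBlock i) := by
    unfold diagonalBlock
    fun_prop
  have hoff : ContDiff 𝕜 ⊤ (offDiagonalBlock i) := by
    unfold offDiagonalBlock
    fun_prop
  have hone : (diagonalBlock i 1).IsInvertible :=
    diagonalBlock_one i ▸ ⟨.refl 𝕜 _, rfl⟩
  have hφ : AnalyticAt 𝕜 (fun T => offDiagonalBlock i T ∘L (diagonalBlock i T).inverse) 1 :=
    (hoff.contDiffAt.clm_comp (hone.contDiffAt_map_inverse.comp _ hdiag.contDiffAt)).analyticAt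
  refine isAnalyticAt_of_eventuallyEq (A := glStructure 𝕜 X) (B := grassmannStructure 𝕜 X)
    (i := ⟨⟩) (j := i) trivial hφ trivial ?_
  have hopen : IsOpen {A : i.1.1.1 →L[𝕜] i.1.1.1 | A.IsInvertible} :=
    ContinuousLinearEquiv.isOpen
  have hcont := hdiag.continuous.comp (Units.continuous_val (M := X →L[𝕜] X))
  filter_upwards [hcont.continuousAt.eventually (hopen.mem_nhds hone)] with W hW
  exact smul_eq_param hW

/-- For `i = (E, F)`, the operator `I + N`, where `N` extends `T : E → F` by zero on `F`. -/
noncomputable def shear (i : ComplPair 𝕜 X) (T : i.1.1.1 →L[𝕜] i.1.2.1) : X →L[𝕜] X :=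
  1 + i.1.2.1.subtypeL ∘L T ∘L
    (i.1.1.1).projectionOntoL i.1.2.1 (Grassmannian.isTopCompl i.2)

theorem shear_apply (i : ComplPair 𝕜 X) (T : i.1.1.1 →L[𝕜] i.1.2.1) (x : X) :
    shear i T x =
      x + T ((i.1.1.1).projectionOntoL i.1.2.1 (Grassmannian.isTopCompl i.2) x) := rfl

theorem shear_mul_shear (i : ComplPair 𝕜 X) (S T : i.1.1.1 →L[𝕜] i.1.2.1) :
    shear i S * shear i T = shear i (S + T) := by
  ext x
  change shear i S (shear i T x) = _
  simp only [shear_apply, map_add, Submodule.projectionOntoL_apply_right, add_zero,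
    map_zero, _root_.add_apply, Submodule.coe_add, Submodule.coe_zero]
  abel

theorem shear_zero (i : ComplPair 𝕜 X) : shear i 0 = 1 := by
  ext x
  simp [shear_apply]

/-- The shear of `T` as an element of `GL X`; its inverse is the shear of `-T`. -/
noncomputable def shearUnit (i : ComplPair 𝕜 X) (T : i.1.1.1 →L[𝕜] i.1.2.1) : BanachGL 𝕜 X where
  val := shear i T
  inv := shear i (-T)
  val_inv := by rw [shear_mul_shear, add_neg_cancel, shear_zero]
  inv_val := by rw [shear_mul_shear, neg_add_cancel, shear_zero]

theorem shearUnit_smul (i : ComplPair 𝕜 X) (T : i.1.1.1 →L[𝕜] i.1.2.1) :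
    shearUnit i T • i.1.1 = param i T := by
  have hshear (e : i.1.1.1) : shear i T e = e + T e := by
    rw [shear_apply, Submodule.projectionOntoL_apply_left]
  refine Subtype.ext (SetLike.ext fun x => ⟨?_, ?_⟩)
  · rintro ⟨e, he, rfl⟩
    exact ⟨⟨e, he⟩, (hshear ⟨e, he⟩).symm⟩
  · rintro ⟨e, rfl⟩
    exact ⟨e, e.2, hshear e⟩

theorem isSubmersion_orbitMap_grassmannian (E : Grassmannian 𝕜 X) :
    IsSubmersion (glStructure 𝕜 X) (grassmannStructure 𝕜 X) fun W : BanachGL 𝕜 X => W • E := by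
  refine isSubmersion_orbitMap isAnalyticAt_one_smul_grassmannian (fun E => ?_) E
  obtain ⟨i, rfl⟩ := exists_complPair E
  have hshear : AnalyticAt 𝕜 (shear i) (coord i i.1.1) := by
    apply ContDiffAt.analyticAt
    unfold shear
    fun_prop
  have hcoord : IsAnalyticAt (grassmannStructure 𝕜 X) (self _) (coord i) i.1.1 :=
    isAnalyticAt_chart (A := grassmannStructure 𝕜 X) (i := i) i.2
  have hzero : coord i i.1.1 = 0 := coord_eq i i.2 0 fun e => by simp
  refine ⟨fun G => shearUnit i (coord i G),
    isAnalyticAt_gl_iff.2 ((isAnalyticAt_self_iff.2 hshear).comp hcoord), Units.ext ?_, ?_⟩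
  · exact (congrArg (shear i) hzero).trans (shear_zero i)
  · filter_upwards [(grassmannChart i).open_source.mem_nhds i.2] with G hG
    rw [shearUnit_smul, param_coord i hG]

end Grassmannian

section Kappa

open BanachStructure MulAction

variable {𝕜 : Type w} [NontriviallyNormedField 𝕜] {X : Type u} [NormedAddCommGroup X]
  [NormedSpace 𝕜 X]

theorem stabilizer_le_stabilizer_kappa (Q : Idem 𝕜 X) :
    stabilizer (BanachGL 𝕜 X) Q ≤ stabilizer (BanachGL 𝕜 X) (kappa Q) := fun W hW =>
  (kappa_smul W Q).symm.trans (congrArg kappa hW)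

theorem kappa_comp_ofQuotientStabilizer (Q : Idem 𝕜 X) :
    kappa ∘ ofQuotientStabilizer (BanachGL 𝕜 X) Q =
      ofQuotientStabilizer (BanachGL 𝕜 X) (kappa Q) ∘
        Subgroup.quotientMapOfLE (stabilizer_le_stabilizer_kappa Q) := by
  refine funext fun p => ?_
  obtain ⟨W, rfl⟩ := QuotientGroup.mk_surjective p
  exact kappa_smul W Q

theorem isAnalytic_quotientMapOfLE [CompleteSpace X] {H K : Subgroup (BanachGL 𝕜 X)} (h : H ≤ K)
    {A : BanachStructure 𝕜 (BanachGL 𝕜 X ⧸ H)} {B : BanachStructure 𝕜 (BanachGL 𝕜 X ⧸ K)}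
    (hA : IsHomogeneousStructure H A) (hB : IsHomogeneousStructure K B) :
    IsAnalytic A B (Subgroup.quotientMapOfLE h) :=
  hA.isAnalytic_of_comp QuotientGroup.mk_surjective hB.1

end Kappa

end BanachHomog

theorem mainTheorem8_general {𝕜 : Type w} [NontriviallyNormedField 𝕜] {X : Type u}
    [NormedAddCommGroup X] [NormedSpace 𝕜 X] [CompleteSpace X] :
    (∃ I : BanachStructure 𝕜 (Idem 𝕜 X),
      IsSubmanifoldStructure I) ∧
    ∀ I : BanachStructure 𝕜 (Idem 𝕜 X),
      IsSubmanifoldStructure I →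
      (∀ Q : Idem 𝕜 X,
        IsBanachLieSubgroup (MulAction.stabilizer (BanachGL 𝕜 X) Q) ∧
        IsClopen (MulAction.orbit (BanachGL 𝕜 X) Q) ∧
        (∃ A, IsHomogeneousStructure
          (MulAction.stabilizer (BanachGL 𝕜 X) Q) A) ∧
        ∀ A, IsHomogeneousStructure
            (MulAction.stabilizer (BanachGL 𝕜 X) Q) A →
          A.IsBianalyticOnto I (MulAction.ofQuotientStabilizer (BanachGL 𝕜 X) Q)
            (MulAction.orbit (BanachGL 𝕜 X) Q)) ∧
      (∀ E : Grassmannian 𝕜 X,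
        IsBanachLieSubgroup (MulAction.stabilizer (BanachGL 𝕜 X) E) ∧
        IsClopen (MulAction.orbit (BanachGL 𝕜 X) E) ∧
        (∃ A, IsHomogeneousStructure
          (MulAction.stabilizer (BanachGL 𝕜 X) E) A) ∧
        ∀ A, IsHomogeneousStructure
            (MulAction.stabilizer (BanachGL 𝕜 X) E) A →
          A.IsBianalyticOnto (grassmannStructure 𝕜 X)
            (MulAction.ofQuotientStabilizer (BanachGL 𝕜 X) E)
            (MulAction.orbit (BanachGL 𝕜 X) E)) ∧
      ((∃ R : Set (Idem 𝕜 X),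
          IsOrbitTransversal (BanachGL 𝕜 X) R) ∧
        ∀ R : Set (Idem 𝕜 X),
          IsOrbitTransversal (BanachGL 𝕜 X) R →
          ∀ A : ∀ Q : R, BanachStructure 𝕜
              (BanachGL 𝕜 X ⧸ MulAction.stabilizer (BanachGL 𝕜 X) Q.1),
            (∀ Q, IsHomogeneousStructure _ (A Q)) →
            (BanachStructure.sigma A).IsBianalyticOnto I
              (fun p => MulAction.ofQuotientStabilizer (BanachGL 𝕜 X) p.1.1 p.2)
              Set.univ) ∧
      ((∃ R : Set (Grassmannian 𝕜 X),
          IsOrbitTransversal (BanachGL 𝕜 X) R) ∧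
        ∀ R : Set (Grassmannian 𝕜 X),
          IsOrbitTransversal (BanachGL 𝕜 X) R →
          ∀ A : ∀ E : R, BanachStructure 𝕜
              (BanachGL 𝕜 X ⧸ MulAction.stabilizer (BanachGL 𝕜 X) E.1),
            (∀ E, IsHomogeneousStructure _ (A E)) →
            (BanachStructure.sigma A).IsBianalyticOnto
              (grassmannStructure 𝕜 X)
              (fun p => MulAction.ofQuotientStabilizer (BanachGL 𝕜 X) p.1.1 p.2)
              Set.univ) ∧
      (∀ Q : Idem 𝕜 X,
        ∃ υ : BanachGL 𝕜 X ⧸ MulAction.stabilizer (BanachGL 𝕜 X) Q →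
            BanachGL 𝕜 X ⧸
              MulAction.stabilizer (BanachGL 𝕜 X) (kappa Q),
          (∀ W : BanachGL 𝕜 X, υ (QuotientGroup.mk W) = QuotientGroup.mk W) ∧
          kappa ∘ MulAction.ofQuotientStabilizer (BanachGL 𝕜 X) Q =
            MulAction.ofQuotientStabilizer (BanachGL 𝕜 X) (kappa Q) ∘ υ ∧
          ∀ A B, IsHomogeneousStructure _ A →
            IsHomogeneousStructure _ B → A.IsAnalytic B υ) := by
  have hGrass := isSubmersion_orbitMap_grassmannian (𝕜 := 𝕜) (X := X)
  refine ⟨exists_isSubmanifoldStructure, fun I hI => ?_⟩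
  have hIdem := isSubmersion_orbitMap_idem hI
  refine ⟨fun Q => ⟨?_, ?_, ?_, ?_⟩, fun E => ⟨?_, ?_, ?_, ?_⟩, ⟨?_, ?_⟩, ⟨?_, ?_⟩, fun Q => ?_⟩
  · exact isBanachLieSubgroup_stabilizer (hIdem Q)
  · exact isClopen_orbit_of_isSubmersion hIdem Q
  · exact exists_isHomogeneousStructure_stabilizer (hIdem Q)
  · exact fun A hA => isBianalyticOnto_ofQuotientStabilizer (hIdem Q) hA
  · exact isBanachLieSubgroup_stabilizer (hGrass E)
  · exact isClopen_orbit_of_isSubmersion hGrass E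
  · exact exists_isHomogeneousStructure_stabilizer (hGrass E)
  · exact fun A hA => isBianalyticOnto_ofQuotientStabilizer (hGrass E) hA
  · exact exists_isOrbitTransversal _
  · exact fun R hR A hA => isBianalyticOnto_sigma_ofQuotientStabilizer hIdem hR hA
  · exact exists_isOrbitTransversal _
  · exact fun R hR A hA => isBianalyticOnto_sigma_ofQuotientStabilizer hGrass hR hA
  · exact ⟨Subgroup.quotientMapOfLE (stabilizer_le_stabilizer_kappa Q), fun W => rfl,
      kappa_comp_ofQuotientStabilizer Q,
      fun A B hA hB => isAnalytic_quotientMapOfLE (stabilizer_le_stabilizer_kappa Q) hA hB⟩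

theorem mainTheorem8 {𝕜 : Type w} [RCLike 𝕜] {X : Type u} [NormedAddCommGroup X]
    [NormedSpace 𝕜 X] [CompleteSpace X] :
    -- the set of idempotents is a submanifold of the space of bounded operators
    (∃ I : BanachStructure 𝕜 (Idem 𝕜 X),
      IsSubmanifoldStructure I) ∧
    ∀ I : BanachStructure 𝕜 (Idem 𝕜 X),
      IsSubmanifoldStructure I →
      -- stabilizers and orbits of idempotents
      (∀ Q : Idem 𝕜 X,
        IsBanachLieSubgroup (MulAction.stabilizer (BanachGL 𝕜 X) Q) ∧
        IsClopen (MulAction.orbit (BanachGL 𝕜 X) Q) ∧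
        (∃ A, IsHomogeneousStructure
          (MulAction.stabilizer (BanachGL 𝕜 X) Q) A) ∧
        ∀ A, IsHomogeneousStructure
            (MulAction.stabilizer (BanachGL 𝕜 X) Q) A →
          A.IsBianalyticOnto I (MulAction.ofQuotientStabilizer (BanachGL 𝕜 X) Q)
            (MulAction.orbit (BanachGL 𝕜 X) Q)) ∧
      -- stabilizers and orbits of complemented subspaces
      (∀ E : Grassmannian 𝕜 X,
        IsBanachLieSubgroup (MulAction.stabilizer (BanachGL 𝕜 X) E) ∧
        IsClopen (MulAction.orbit (BanachGL 𝕜 X) E) ∧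
        (∃ A, IsHomogeneousStructure
          (MulAction.stabilizer (BanachGL 𝕜 X) E) A) ∧
        ∀ A, IsHomogeneousStructure
            (MulAction.stabilizer (BanachGL 𝕜 X) E) A →
          A.IsBianalyticOnto (grassmannStructure 𝕜 X)
            (MulAction.ofQuotientStabilizer (BanachGL 𝕜 X) E)
            (MulAction.orbit (BanachGL 𝕜 X) E)) ∧
      -- the space of idempotents is a disjoint union of homogeneous spaces
      ((∃ R : Set (Idem 𝕜 X),
          IsOrbitTransversal (BanachGL 𝕜 X) R) ∧
        ∀ R : Set (Idem 𝕜 X),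
          IsOrbitTransversal (BanachGL 𝕜 X) R →
          ∀ A : ∀ Q : R, BanachStructure 𝕜
              (BanachGL 𝕜 X ⧸ MulAction.stabilizer (BanachGL 𝕜 X) Q.1),
            (∀ Q, IsHomogeneousStructure _ (A Q)) →
            (BanachStructure.sigma A).IsBianalyticOnto I
              (fun p => MulAction.ofQuotientStabilizer (BanachGL 𝕜 X) p.1.1 p.2)
              Set.univ) ∧
      -- the Grassmann manifold is a disjoint union of homogeneous spaces
      ((∃ R : Set (Grassmannian 𝕜 X),
          IsOrbitTransversal (BanachGL 𝕜 X) R) ∧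
        ∀ R : Set (Grassmannian 𝕜 X),
          IsOrbitTransversal (BanachGL 𝕜 X) R →
          ∀ A : ∀ E : R, BanachStructure 𝕜
              (BanachGL 𝕜 X ⧸ MulAction.stabilizer (BanachGL 𝕜 X) E.1),
            (∀ E, IsHomogeneousStructure _ (A E)) →
            (BanachStructure.sigma A).IsBianalyticOnto
              (grassmannStructure 𝕜 X)
              (fun p => MulAction.ofQuotientStabilizer (BanachGL 𝕜 X) p.1.1 p.2)
              Set.univ) ∧
      -- `kappa` corresponds to the natural analytic map between the quotients
      (∀ Q : Idem 𝕜 X,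
        ∃ υ : BanachGL 𝕜 X ⧸ MulAction.stabilizer (BanachGL 𝕜 X) Q →
            BanachGL 𝕜 X ⧸
              MulAction.stabilizer (BanachGL 𝕜 X) (kappa Q),
          (∀ W : BanachGL 𝕜 X, υ (QuotientGroup.mk W) = QuotientGroup.mk W) ∧
          kappa ∘ MulAction.ofQuotientStabilizer (BanachGL 𝕜 X) Q =
            MulAction.ofQuotientStabilizer (BanachGL 𝕜 X) (kappa Q) ∘ υ ∧
          ∀ A B, IsHomogeneousStructure _ A →
            IsHomogeneousStructure _ B → A.IsAnalytic B υ) :=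
  mainTheorem8_general
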